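/- Let $M$ be a smooth $n$-dimensional manifold with boundary ($n\ge 1$), let $\kappa\in\mathbb R$ be a constant, $T\in\mathbb R$, and let $g(t)$, $0<t<T$, be a family of Riemannian metrics on $M$, smooth on $M\times(0,T)$ up to the boundary, with $$\partial_t g=-2\,\mathrm{Ric}(g)\ \text{ on } M\times(0,T),\qquad h=\kappa g \ \text{ on } \partial M\times(0,T),$$ where $\nu$ is the outward unit normal of $\partial M$ with respect to $g(t)$ and $h(X,Y)=g(\nabla_X\nu,Y)$, for $X,Y$ tangent to $\partial M$, is the second fundamental form. Write $R_{ij}$ for the Ricci tensor, $R$ for the scalar curvature, $\nabla$ for the Levi-Civita connection of $g(t)$, $R_{\nu\nu}=\mathrm{Ric}(\nu,\nu)$; Greek indices $\alpha,\beta$ denote directions tangent to $\partial M$, and $(g^{\alpha\beta})$ is the inverse of the metric $(g_{\alpha\beta})$ induced on $\partial M$. Then at every point of $\partial M$ and every time $t\in(0,T)$, $$\nabla_\nu R_{\alpha\beta}=R_{\nu\nu}\,h_{\alpha\beta}\quad\text{for all tangential }\alpha,\beta,$$ where $\nabla_\nu R_{\alpha\beta}=(\nabla_\nu\mathrm{Ric})(\partial_\alpha,\partial_\beta)$,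 and $$\frac{\partial R}{\partial\nu}=2\kappa\, g^{\alpha\beta}R_{\alpha\beta}.$$ -/

import Mathlib

open Set Bundle
open scoped Manifold ContDiff

noncomputable section

namespace UmbilicRicciFlow

/-! ### Tensor calculus in one coordinate system

`S` is the (relatively open) domain of the coordinates in the closed half-space
`{y | 0 ≤ y 0}` and `G y` is the matrix `(g_{ij}(y))` of the metric at the point with
coordinates `y`.  Derivatives are taken within `S`, hence are one-sided in the
direction `0` at points of the boundary. -/

section Coordinates

variable {n : ℕ}

/-- The partial derivative `∂_i f`. -/
def pd (S : Set (EuclideanSpace ℝ (Fin n))) (i : Fin n) (f : EuclideanSpace ℝ (Fin n) → ℝ)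
    (y : EuclideanSpace ℝ (Fin n)) : ℝ :=
  fderivWithin ℝ f S y (EuclideanSpace.single i 1)

/-- The Christoffel symbols
`Γ^k_{ij} = (1/2) g^{kl} (∂_i g_{jl} + ∂_j g_{il} - ∂_l g_{ij})`. -/
def christoffel (S : Set (EuclideanSpace ℝ (Fin n)))
    (G : EuclideanSpace ℝ (Fin n) → Matrix (Fin n) (Fin n) ℝ) (k i j : Fin n)
    (y : EuclideanSpace ℝ (Fin n)) : ℝ :=
  (1 / 2) * ∑ l, (G y)⁻¹ k l *
    (pd S i (fun z => G z j l) y + pd S j (fun z => G z i l) y - pd S l (fun z => G z i j) y)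

/-- The components `R^l_{ijk}` of the curvature tensor, with the convention
`R(∂_i, ∂_j) ∂_k = ∇_i ∇_j ∂_k - ∇_j ∇_i ∂_k = R^l_{ijk} ∂_l`. -/
def riemann (S : Set (EuclideanSpace ℝ (Fin n)))
    (G : EuclideanSpace ℝ (Fin n) → Matrix (Fin n) (Fin n) ℝ) (l i j k : Fin n)
    (y : EuclideanSpace ℝ (Fin n)) : ℝ :=
  pd S i (christoffel S G l j k) y - pd S j (christoffel S G l i k) y
    + ∑ m, (christoffel S G l i m y * christoffel S G m j k y
      - christoffel S G l j m y * christoffel S G m i k y)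

/-- The Ricci tensor `R_{jk} = R^i_{ijk}` (positive on round spheres). -/
def ricci (S : Set (EuclideanSpace ℝ (Fin n)))
    (G : EuclideanSpace ℝ (Fin n) → Matrix (Fin n) (Fin n) ℝ) (j k : Fin n)
    (y : EuclideanSpace ℝ (Fin n)) : ℝ :=
  ∑ i, riemann S G i i j k y

/-- The scalar curvature `R = g^{ij} R_{ij}`. -/
def scalarCurv (S : Set (EuclideanSpace ℝ (Fin n)))
    (G : EuclideanSpace ℝ (Fin n) → Matrix (Fin n) (Fin n) ℝ)
    (y : EuclideanSpace ℝ (Fin n)) : ℝ :=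
  ∑ i, ∑ j, (G y)⁻¹ i j * ricci S G i j y

/-- The components `∇_k R_{ij} = ∂_k R_{ij} - Γ^l_{ki} R_{lj} - Γ^l_{kj} R_{il}` of the
covariant derivative of the Ricci tensor. -/
def covRicci (S : Set (EuclideanSpace ℝ (Fin n)))
    (G : EuclideanSpace ℝ (Fin n) → Matrix (Fin n) (Fin n) ℝ) (k i j : Fin n)
    (y : EuclideanSpace ℝ (Fin n)) : ℝ :=
  pd S k (ricci S G i j) y
    - ∑ l, (christoffel S G l k i y * ricci S G l j y + christoffel S G l k j y * ricci S G i l y)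

variable [NeZero n]

/-- The components of the outward unit normal `ν = -grad x⁰ / |grad x⁰|`, that is
`ν^i = -g^{i0} / √(g^{00})`.  (The manifold lies on the side `x⁰ ≥ 0` of its boundary.) -/
def normal (G : EuclideanSpace ℝ (Fin n) → Matrix (Fin n) (Fin n) ℝ) (i : Fin n)
    (y : EuclideanSpace ℝ (Fin n)) : ℝ :=
  -((G y)⁻¹ i 0) / √((G y)⁻¹ 0 0)

/-- The second fundamental form of the boundary with respect to the outward unit normal,
`h_{αβ} = g(∇_α ν, ∂_β)`; it is meaningful for tangential indices `α, β ≠ 0`. -/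
def secondFF (S : Set (EuclideanSpace ℝ (Fin n)))
    (G : EuclideanSpace ℝ (Fin n) → Matrix (Fin n) (Fin n) ℝ) (α β : Fin n)
    (y : EuclideanSpace ℝ (Fin n)) : ℝ :=
  ∑ j, G y j β * (pd S α (normal G j) y + ∑ k, christoffel S G j α k y * normal G k y)

/-- The normal-normal component `R_{νν} = R_{ij} ν^i ν^j`. -/
def ricciNN (S : Set (EuclideanSpace ℝ (Fin n)))
    (G : EuclideanSpace ℝ (Fin n) → Matrix (Fin n) (Fin n) ℝ)
    (y : EuclideanSpace ℝ (Fin n)) : ℝ :=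
  ∑ i, ∑ j, ricci S G i j y * normal G i y * normal G j y

/-- The matrix `(g_{αβ})`, `α, β ≠ 0`, of the metric induced on the boundary. -/
def bdryMetric (G : EuclideanSpace ℝ (Fin n) → Matrix (Fin n) (Fin n) ℝ)
    (y : EuclideanSpace ℝ (Fin n)) : Matrix {i : Fin n // i ≠ 0} {i : Fin n // i ≠ 0} ℝ :=
  (G y).submatrix Subtype.val Subtype.val

/-- The tangential trace `g^{αβ} R_{αβ}`, where `(g^{αβ})` is the inverse of the metric induced
on the boundary and `α, β` run over the tangential indices. -/
def tangentialTraceRicci (S : Set (EuclideanSpace ℝ (Fin n)))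
    (G : EuclideanSpace ℝ (Fin n) → Matrix (Fin n) (Fin n) ℝ)
    (y : EuclideanSpace ℝ (Fin n)) : ℝ :=
  ∑ α : {i : Fin n // i ≠ 0}, ∑ β : {i : Fin n // i ≠ 0},
    (bdryMetric G y)⁻¹ α β * ricci S G α β y

end Coordinates

/-! ### Metrics on a manifold with boundary -/

section Manifold

variable {n : ℕ} [NeZero n] {M : Type*} [TopologicalSpace M]
  [ChartedSpace (EuclideanHalfSpace n) M]

/-- The domain of the coordinates of the chart `e`, a relatively open subset of the closed
half-space. -/
def coordDomain (e : OpenPartialHomeomorph M (EuclideanHalfSpace n)) :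
    Set (EuclideanSpace ℝ (Fin n)) :=
  (e.extend (𝓡∂ n)).target

/-- The coordinate vector field `∂_i` of the chart `e`, at the point with coordinates `y`. -/
def coordVector (e : OpenPartialHomeomorph M (EuclideanHalfSpace n)) (i : Fin n)
    (y : EuclideanSpace ℝ (Fin n)) : TangentSpace (𝓡∂ n) ((e.extend (𝓡∂ n)).symm y) :=
  mfderivWithin 𝓘(ℝ, EuclideanSpace ℝ (Fin n)) (𝓡∂ n) (e.extend (𝓡∂ n)).symm
    (range (𝓡∂ n)) y (EuclideanSpace.single i (1 : ℝ) : EuclideanSpace ℝ (Fin n))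

/-- The matrix `g_{ij} = g(∂_i, ∂_j)` of a metric in the chart `e`. -/
def coeff (g : RiemannianMetric (fun x : M => TangentSpace (𝓡∂ n) x))
    (e : OpenPartialHomeomorph M (EuclideanHalfSpace n)) (y : EuclideanSpace ℝ (Fin n)) :
    Matrix (Fin n) (Fin n) ℝ :=
  Matrix.of fun i j =>
    g.inner ((e.extend (𝓡∂ n)).symm y) (coordVector e i y) (coordVector e j y)

/-- The family `g t`, `0 < t < T`, of Riemannian metrics on the manifold with boundary `M` is
smooth on `M × (0, T)` (up to the boundary of `M`), solves the Ricci flow `∂_t g = -2 Ric(g)`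
there, and its boundary satisfies `h = κ g` with `κ` constant.  As usual in tensor notation, the
equations between components are required in every smooth chart.  Nothing is required of `g t`
for `t` outside `(0, T)`. -/
structure IsUmbilicRicciFlow (κ T : ℝ)
    (g : ℝ → RiemannianMetric (fun x : M => TangentSpace (𝓡∂ n) x)) : Prop where
  smooth : ∀ e ∈ IsManifold.maximalAtlas (𝓡∂ n) ∞ M, ∀ i j : Fin n,
    ContDiffOn ℝ ∞ (fun z : ℝ × EuclideanSpace ℝ (Fin n) => coeff (g z.1) e z.2 i j)
      (Ioo 0 T ×ˢ coordDomain e)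
  flow : ∀ e ∈ IsManifold.maximalAtlas (𝓡∂ n) ∞ M, ∀ t ∈ Ioo 0 T, ∀ p ∈ e.source, ∀ i j : Fin n,
    HasDerivAt (fun s => coeff (g s) e (e.extend (𝓡∂ n) p) i j)
      (-2 * ricci (coordDomain e) (coeff (g t) e) i j (e.extend (𝓡∂ n) p)) t
  umbilic : ∀ e ∈ IsManifold.maximalAtlas (𝓡∂ n) ∞ M, ∀ t ∈ Ioo 0 T,
    ∀ p ∈ (𝓡∂ n).boundary M, p ∈ e.source → ∀ α β : Fin n, α ≠ 0 → β ≠ 0 →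
    secondFF (coordDomain e) (coeff (g t) e) α β (e.extend (𝓡∂ n) p)
      = κ * coeff (g t) e (e.extend (𝓡∂ n) p) α β

end Manifold

end UmbilicRicciFlow

end

noncomputable section

namespace UmbilicRicciFlow

/-! ### Partial derivatives within a relatively open piece of the half-space. -/

section Calculus

variable {n : ℕ} {S : Set (EuclideanSpace ℝ (Fin n))} {y : EuclideanSpace ℝ (Fin n)}
  {f g : EuclideanSpace ℝ (Fin n) → ℝ}

/-! Fix a chart and put `w = √g^{00}`. Since the conormal of `ν` is `-dx⁰ / w`, the second
fundamental form is `Γ^0_{αβ} / w` (`secondFF_eq`), so the boundary condition says `Γ^0_{αβ} = κ w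
g_{αβ}` along the boundary, at every time. This single identity is differentiated twice:
tangentially and in time.

Tangentially it gives the Codazzi equation `R^0_{αβγ} = 0` (`riemann_zero`), because `κ` is
constant. Tracing yields `R_{βν} = 0` along the boundary (`ricciConormal_eq_zero`), and one more
tangential derivative gives `g^{0l} ∇_α R_{βl} = κ w (R_{αβ} - g_{αβ} R_{νν})`
(`sum_covRicci_tangential`).

In time, the left side varies by `-g^{0l} (∇_α R_{βl} + ∇_β R_{αl} - ∇_l R_{αβ})`
(`hasDerivAt_christoffel`), while `∂_t w = w R_{νν}` and `∂_t g_{αβ} = -2 R_{αβ}`. After inserting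
the tangential formula the `R_{αβ}` terms cancel and `g^{0l} ∇_l R_{αβ} = -κ w g_{αβ} R_{νν}`
remains (`sum_covRicci_conormal`). Division by `-w` gives the first claim.

For the scalar curvature, `∂_ν R` is the tangential trace of `∇_ν R_{αβ}` plus `∇_ν R_{νν}`; by the
contracted Bianchi identity (`contracted_bianchi`) it is also twice the sum of the tangential
divergence of `R_{αν}` and `∇_ν R_{νν}`. Eliminating the unknown `∇_ν R_{νν}` leaves only terms
already computed, in which `R_{νν}` cancels. -/

theorem contDiffOn_pd (hS : UniqueDiffOn ℝ S) (i : Fin n) (hf : ContDiffOn ℝ ∞ f S) :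
    ContDiffOn ℝ ∞ (pd S i f) S :=
  (hf.fderivWithin hS (by simp)).clm_apply contDiffOn_const

theorem pd_congr (h : EqOn f g S) (hy : y ∈ S) (i : Fin n) : pd S i f y = pd S i g y := by
  simp only [pd, fderivWithin_congr h (h hy)]

theorem differentiableWithinAt_of_contDiffOn (hf : ContDiffOn ℝ ∞ f S) (hy : y ∈ S) :
    DifferentiableWithinAt ℝ f S y :=
  (hf y hy).differentiableWithinAt (by simp)

theorem pd_add (hS : UniqueDiffOn ℝ S) (hf : ContDiffOn ℝ ∞ f S) (hg : ContDiffOn ℝ ∞ g S)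
    (hy : y ∈ S) (i : Fin n) : pd S i (fun z => f z + g z) y = pd S i f y + pd S i g y := by
  simp [pd, fderivWithin_fun_add (hS y hy) (differentiableWithinAt_of_contDiffOn hf hy)
    (differentiableWithinAt_of_contDiffOn hg hy)]

theorem pd_sub (hS : UniqueDiffOn ℝ S) (hf : ContDiffOn ℝ ∞ f S) (hg : ContDiffOn ℝ ∞ g S)
    (hy : y ∈ S) (i : Fin n) : pd S i (fun z => f z - g z) y = pd S i f y - pd S i g y := by
  simp [pd, fderivWithin_fun_sub (hS y hy) (differentiableWithinAt_of_contDiffOn hf hy)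
    (differentiableWithinAt_of_contDiffOn hg hy)]

theorem pd_mul (hS : UniqueDiffOn ℝ S) (hf : ContDiffOn ℝ ∞ f S) (hg : ContDiffOn ℝ ∞ g S)
    (hy : y ∈ S) (i : Fin n) :
    pd S i (fun z => f z * g z) y = pd S i f y * g y + f y * pd S i g y := by
  simp [pd, fderivWithin_fun_mul (hS y hy) (differentiableWithinAt_of_contDiffOn hf hy)
    (differentiableWithinAt_of_contDiffOn hg hy)]
  ring

theorem pd_const (i : Fin n) (c : ℝ) : pd S i (fun _ => c) y = 0 := by
  simp [pd]

theorem pd_sum {ι : Type*} [Fintype ι] {f : ι → EuclideanSpace ℝ (Fin n) → ℝ}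
    (hS : UniqueDiffOn ℝ S) (hf : ∀ a, ContDiffOn ℝ ∞ (f a) S) (hy : y ∈ S) (i : Fin n) :
    pd S i (fun z => ∑ a, f a z) y = ∑ a, pd S i (f a) y := by
  simp [pd, fderivWithin_fun_sum (hS y hy)
    (fun a _ => differentiableWithinAt_of_contDiffOn (hf a) hy)]

/-- Partial derivatives commute, also at the boundary. -/
theorem pd_comm (hS : UniqueDiffOn ℝ S) (hS' : S ⊆ closure (interior S))
    (hf : ContDiffOn ℝ ∞ f S) (hy : y ∈ S) (i j : Fin n) :
    pd S i (pd S j f) y = pd S j (pd S i f) y := by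
  have hd : DifferentiableWithinAt ℝ (fderivWithin ℝ f S) S y :=
    ((hf.fderivWithin hS (m := ∞) (by simp)) y hy).differentiableWithinAt (by simp)
  have key : ∀ v w, fderivWithin ℝ (fun z => fderivWithin ℝ f S z v) S y w
      = fderivWithin ℝ (fderivWithin ℝ f S) S y w v := by
    intro v w
    rw [fderivWithin_clm_apply (hS y hy) hd (differentiableWithinAt_const v)]
    simp
  have hsymm := (hf y hy).isSymmSndFDerivWithinAt (by simpa using ENat.LEInfty.out) hS (hS' hy) hy
  change fderivWithin ℝ (fun z => fderivWithin ℝ f S z _) S y _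
    = fderivWithin ℝ (fun z => fderivWithin ℝ f S z _) S y _
  rw [key, key, hsymm.eq]

/-- The tangential derivatives of a function at the boundary only depend on its restriction to
the boundary. -/
theorem pd_eq_of_eqOn_boundary [NeZero n] {U : Set (EuclideanSpace ℝ (Fin n))} (hU : IsOpen U)
    (hSU : S = U ∩ {z | 0 ≤ z 0}) (hf : ContDiffOn ℝ ∞ f S)
    (hg : ContDiffOn ℝ ∞ g S) (h : ∀ z ∈ S, z 0 = 0 → f z = g z) (hy : y ∈ S) (hy0 : y 0 = 0)
    {α : Fin n} (hα : α ≠ 0) : pd S α f y = pd S α g y := by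
  set v : EuclideanSpace ℝ (Fin n) := EuclideanSpace.single α 1
  set B : Set (EuclideanSpace ℝ (Fin n)) := S ∩ {z | z 0 = 0}
  have hv : v 0 = 0 := by simp [v, hα.symm]
  -- The line in direction `α ≠ 0` stays on the boundary hyperplane, hence in `S` for small `s` of
  -- either sign; this turns the derivative within `S` into an ordinary derivative along the line.
  let γ : ℝ → EuclideanSpace ℝ (Fin n) := fun s => y + s • v
  have hγ : HasDerivAt γ v 0 := by
    simpa [γ] using ((hasDerivAt_id (0 : ℝ)).smul_const v).const_add y
  have hγ0 : γ 0 = y := by simp [γ]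
  have hmem : ∀ᶠ s in nhds (0 : ℝ), γ s ∈ S := by
    have : ∀ᶠ s in nhds (0 : ℝ), γ s ∈ U :=
      hγ.continuousAt.eventually_mem (hU.mem_nhds (by rw [hγ0]; rw [hSU] at hy; exact hy.1))
    filter_upwards [this] with s hs
    rw [hSU]
    refine ⟨hs, ?_⟩
    simp [γ, hv, hy0]
  have key : ∀ {φ : EuclideanSpace ℝ (Fin n) → ℝ}, ContDiffOn ℝ ∞ φ S →
      HasDerivAt (fun s => φ (γ s)) (pd S α φ y) 0 := by
    intro φ hφ
    have h1 := (differentiableWithinAt_of_contDiffOn hφ hy).hasFDerivWithinAt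
    rw [← hγ0] at h1
    have := h1.comp_hasDerivWithinAt (f := γ) (s := γ ⁻¹' S) 0 hγ.hasDerivWithinAt
      (fun s hs => hs)
    rw [hγ0] at this
    exact this.hasDerivAt hmem
  have hfg : (fun s => f (γ s)) =ᶠ[nhds 0] fun s => g (γ s) := by
    filter_upwards [hmem] with s hs
    exact h _ hs (by simp [γ, hv, hy0])
  exact (key hf).unique ((key hg).congr_of_eventuallyEq hfg)

/-- The time derivative commutes with partial derivatives. -/
theorem hasDerivAt_pd {J : Set ℝ} (hJ : IsOpen J) (hS : UniqueDiffOn ℝ S)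
    (hS' : S ⊆ closure (interior S)) {H : ℝ → EuclideanSpace ℝ (Fin n) → ℝ}
    (hH : ContDiffOn ℝ ∞ (fun z : ℝ × EuclideanSpace ℝ (Fin n) => H z.1 z.2) (J ×ˢ S))
    {t : ℝ} (ht : t ∈ J) (hg : ∀ z ∈ S, HasDerivAt (fun s => H s z) (g z) t) (hy : y ∈ S)
    (i : Fin n) : HasDerivAt (fun s => pd S i (H s) y) (pd S i g y) t := by
  set Ω := J ×ˢ S
  set K : ℝ × EuclideanSpace ℝ (Fin n) → ℝ := fun z => H z.1 z.2
  set v : EuclideanSpace ℝ (Fin n) := EuclideanSpace.single i 1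
  have hΩ : UniqueDiffOn ℝ Ω := hJ.uniqueDiffOn.prod hS
  have hΩ' : (t, y) ∈ closure (interior Ω) := by
    rw [interior_prod_eq, closure_prod_eq, hJ.interior_eq]
    exact ⟨subset_closure ht, hS' hy⟩
  have hd : DifferentiableWithinAt ℝ (fderivWithin ℝ K Ω) Ω (t, y) :=
    ((hH.fderivWithin hΩ (m := ∞) (by simp)) (t, y) ⟨ht, hy⟩).differentiableWithinAt (by simp)
  -- Both mixed derivatives are values of the second derivative of `K` on space-time at `(1, 0)` and
  -- `(0, v)`, in opposite orders; its symmetry, valid up to the boundary, is the whole point.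
  have hsymm := (hH (t, y) ⟨ht, hy⟩).isSymmSndFDerivWithinAt (by simpa using ENat.LEInfty.out) hΩ hΩ' ⟨ht, hy⟩
  have hK : ∀ s ∈ J, ∀ z ∈ S, HasFDerivWithinAt K (fderivWithin ℝ K Ω (s, z)) Ω (s, z) :=
    fun s hs z hz => ((hH (s, z) ⟨hs, hz⟩).differentiableWithinAt (by simp)).hasFDerivWithinAt
  have htime : ∀ {F : Type} [NormedAddCommGroup F] [NormedSpace ℝ F]
      {φ : ℝ × EuclideanSpace ℝ (Fin n) → F}
      {φ' : ℝ × EuclideanSpace ℝ (Fin n) →L[ℝ] F} {z}, z ∈ S →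
      HasFDerivWithinAt φ φ' Ω (t, z) → HasDerivAt (fun s => φ (s, z)) (φ' (1, 0)) t := by
    intro F _ _ φ φ' z hz h
    have hc : HasDerivAt (fun s : ℝ => (s, z)) (1, 0) t :=
      (hasDerivAt_id t).prodMk (hasDerivAt_const t z)
    exact (h.comp_hasDerivWithinAt (f := fun s => (s, z)) (s := J) t hc.hasDerivWithinAt
      (fun s hs => ⟨hs, hz⟩)).hasDerivAt (hJ.mem_nhds ht)
  have hspace : ∀ {F : Type} [NormedAddCommGroup F] [NormedSpace ℝ F]
      {φ : ℝ × EuclideanSpace ℝ (Fin n) → F}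
      {φ' : ℝ × EuclideanSpace ℝ (Fin n) →L[ℝ] F} {s z}, s ∈ J → z ∈ S →
      HasFDerivWithinAt φ φ' Ω (s, z) →
      fderivWithin ℝ (fun x => φ (s, x)) S z v = φ' (0, v) := by
    intro F _ _ φ φ' s z hs hz h
    have hc : HasFDerivWithinAt (fun x : EuclideanSpace ℝ (Fin n) => (s, x))
        (ContinuousLinearMap.inr ℝ ℝ (EuclideanSpace ℝ (Fin n))) S z :=
      (hasFDerivAt_prodMk_right s z).hasFDerivWithinAt
    have := (HasFDerivWithinAt.comp z h hc (fun x hx => ⟨hs, hx⟩)).fderivWithin (hS z hz)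
    change fderivWithin ℝ (φ ∘ fun x => (s, x)) S z v = _
    rw [this]
    simp
  have h1 : ∀ s ∈ J, pd S i (H s) y = fderivWithin ℝ K Ω (s, y) (0, v) := fun s hs =>
    hspace (φ := K) hs hy (hK s hs y hy)
  have h2 : ∀ z ∈ S, g z = fderivWithin ℝ K Ω (t, z) (1, 0) := fun z hz =>
    (hg z hz).unique (htime hz (hK t ht z hz))
  have key : ∀ u : ℝ × EuclideanSpace ℝ (Fin n),
      HasFDerivWithinAt (fun z => fderivWithin ℝ K Ω z u)
        ((fderivWithin ℝ (fderivWithin ℝ K Ω) Ω (t, y)).flip u) Ω (t, y) := by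
    intro u
    have := hd.hasFDerivWithinAt.clm_apply (hasFDerivWithinAt_const u (t, y) Ω)
    simpa using this
  have h3 := htime hy (key (0, v))
  have h4 : pd S i g y = (fderivWithin ℝ (fderivWithin ℝ K Ω) Ω (t, y)).flip (1, 0) (0, v) := by
    rw [pd_congr (g := fun z => fderivWithin ℝ K Ω (t, z) (1, 0)) h2 hy]
    exact hspace ht hy (key (1, 0))
  rw [h4]
  have h5 : (fderivWithin ℝ (fderivWithin ℝ K Ω) Ω (t, y)).flip (0, v) (1, 0)
      = (fderivWithin ℝ (fderivWithin ℝ K Ω) Ω (t, y)).flip (1, 0) (0, v) := hsymm.eq _ _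
  rw [← h5]
  refine h3.congr_of_eventuallyEq ?_
  filter_upwards [hJ.mem_nhds ht] with s hs using h1 s hs

/-- The entries of the inverse of a smooth matrix-valued function are smooth. -/
theorem contDiffOn_matrix_inv {E : Type*} [NormedAddCommGroup E] [NormedSpace ℝ E] {s : Set E}
    {ι : Type*} [Fintype ι] [DecidableEq ι] {A : E → Matrix ι ι ℝ}
    (hA : ∀ i j, ContDiffOn ℝ ∞ (fun z => A z i j) s) (hdet : ∀ z ∈ s, (A z).det ≠ 0) (i j : ι) :
    ContDiffOn ℝ ∞ (fun z => (A z)⁻¹ i j) s := by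
  have hd : ∀ {B : E → Matrix ι ι ℝ}, (∀ i j, ContDiffOn ℝ ∞ (fun z => B z i j) s) →
      ContDiffOn ℝ ∞ (fun z => (B z).det) s := by
    intro B hB
    simp only [Matrix.det_apply]
    exact ContDiffOn.sum fun σ _ => (contDiffOn_prod fun k _ => hB _ _).const_smul _
  -- Cramer's rule: an adjugate entry is the determinant of `A` with one row replaced by a constant
  -- vector.
  have hadj : ContDiffOn ℝ ∞ (fun z => (A z).adjugate i j) s := by
    simp only [Matrix.adjugate_apply]
    refine hd fun k l => ?_
    by_cases hk : k = j
    · subst hk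
      simp only [Matrix.updateRow_self]
      exact contDiffOn_const
    · simp only [Matrix.updateRow_ne hk]
      exact hA k l
  refine (((hd hA).inv hdet).mul hadj).congr fun z _ => ?_
  simp [Matrix.inv_def]

end Calculus

/-! ### Entrywise differentiation of matrix-valued functions. -/

section MatrixCalculus

variable {n : ℕ} {S : Set (EuclideanSpace ℝ (Fin n))} {y : EuclideanSpace ℝ (Fin n)}
  {A B : EuclideanSpace ℝ (Fin n) → Matrix (Fin n) (Fin n) ℝ}

/-- The entrywise partial derivative of a matrix-valued function. -/
def pdMat (S : Set (EuclideanSpace ℝ (Fin n))) (i : Fin n)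
    (A : EuclideanSpace ℝ (Fin n) → Matrix (Fin n) (Fin n) ℝ) (y : EuclideanSpace ℝ (Fin n)) :
    Matrix (Fin n) (Fin n) ℝ :=
  Matrix.of fun k l => pd S i (fun z => A z k l) y

/-- All entries of the matrix-valued function `A` are smooth on `S`. -/
def SmoothMat (S : Set (EuclideanSpace ℝ (Fin n)))
    (A : EuclideanSpace ℝ (Fin n) → Matrix (Fin n) (Fin n) ℝ) : Prop :=
  ∀ k l, ContDiffOn ℝ ∞ (fun z => A z k l) S

theorem SmoothMat.add (hA : SmoothMat S A) (hB : SmoothMat S B) :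
    SmoothMat S (fun z => A z + B z) := fun k l => (hA k l).add (hB k l)

theorem SmoothMat.sub (hA : SmoothMat S A) (hB : SmoothMat S B) :
    SmoothMat S (fun z => A z - B z) := fun k l => (hA k l).sub (hB k l)

theorem SmoothMat.mul (hA : SmoothMat S A) (hB : SmoothMat S B) :
    SmoothMat S (fun z => A z * B z) := fun k l => by
  simp only [Matrix.mul_apply]
  exact ContDiffOn.sum fun m _ => (hA k m).mul (hB m l)

theorem SmoothMat.transpose (hA : SmoothMat S A) :
    SmoothMat S (fun z => (A z).transpose) := fun k l => hA l k

theorem SmoothMat.pdMat (hS : UniqueDiffOn ℝ S) (hA : SmoothMat S A) (i : Fin n) :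
    SmoothMat S (pdMat S i A) := fun k l => contDiffOn_pd hS i (hA k l)

theorem pdMat_congr (h : EqOn A B S) (hy : y ∈ S) (i : Fin n) :
    pdMat S i A y = pdMat S i B y := by
  ext k l
  exact pd_congr (fun z hz => by simp only [h hz]) hy i

theorem pdMat_add (hS : UniqueDiffOn ℝ S) (hA : SmoothMat S A) (hB : SmoothMat S B) (hy : y ∈ S)
    (i : Fin n) : pdMat S i (fun z => A z + B z) y = pdMat S i A y + pdMat S i B y := by
  ext k l
  exact pd_add hS (hA k l) (hB k l) hy i

theorem pdMat_sub (hS : UniqueDiffOn ℝ S) (hA : SmoothMat S A) (hB : SmoothMat S B) (hy : y ∈ S)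
    (i : Fin n) : pdMat S i (fun z => A z - B z) y = pdMat S i A y - pdMat S i B y := by
  ext k l
  exact pd_sub hS (hA k l) (hB k l) hy i

theorem pdMat_mul (hS : UniqueDiffOn ℝ S) (hA : SmoothMat S A) (hB : SmoothMat S B) (hy : y ∈ S)
    (i : Fin n) :
    pdMat S i (fun z => A z * B z) y = pdMat S i A y * B y + A y * pdMat S i B y := by
  ext k l
  simp only [pdMat, Matrix.of_apply, Matrix.mul_apply, Matrix.add_apply]
  rw [pd_sum hS (fun m => (hA k m).mul (hB m l)) hy, ← Finset.sum_add_distrib]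
  exact Finset.sum_congr rfl fun m _ => pd_mul hS (hA k m) (hB m l) hy i

theorem pdMat_transpose (i : Fin n) :
    pdMat S i (fun z => (A z).transpose) y = (pdMat S i A y).transpose := rfl

theorem pdMat_comm (hS : UniqueDiffOn ℝ S) (hS' : S ⊆ closure (interior S))
    (hA : SmoothMat S A) (hy : y ∈ S) (i j : Fin n) :
    pdMat S i (pdMat S j A) y = pdMat S j (pdMat S i A) y := by
  ext k l
  exact pd_comm hS hS' (hA k l) hy i j

end MatrixCalculus

/-! ### Levi-Civita connection, curvature and the second Bianchi identity in matrix form. -/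

section Curvature

variable {n : ℕ} {S : Set (EuclideanSpace ℝ (Fin n))} {y : EuclideanSpace ℝ (Fin n)}
  {G : EuclideanSpace ℝ (Fin n) → Matrix (Fin n) (Fin n) ℝ}

/-- `G` is a smooth Riemannian metric on the coordinate domain `S`. -/
structure IsCoordMetric (S : Set (EuclideanSpace ℝ (Fin n)))
    (G : EuclideanSpace ℝ (Fin n) → Matrix (Fin n) (Fin n) ℝ) : Prop where
  uniqueDiffOn : UniqueDiffOn ℝ S
  subset_closure : S ⊆ closure (interior S)
  smooth : SmoothMat S G
  posDef : ∀ z ∈ S, (G z).PosDef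

namespace IsCoordMetric

theorem isUnit_det (h : IsCoordMetric S G) (hy : y ∈ S) : IsUnit (G y).det :=
  (h.posDef y hy).det_pos.ne'.isUnit

theorem transpose_eq (h : IsCoordMetric S G) (hy : y ∈ S) : (G y).transpose = G y := by
  simpa using (h.posDef y hy).isHermitian.eq

theorem symm (h : IsCoordMetric S G) (hy : y ∈ S) (i j : Fin n) : G y i j = G y j i :=
  congrFun (congrFun (h.transpose_eq hy) j) i

theorem inv_transpose_eq (h : IsCoordMetric S G) (hy : y ∈ S) :
    ((G y)⁻¹).transpose = (G y)⁻¹ := by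
  rw [Matrix.transpose_nonsing_inv, h.transpose_eq hy]

theorem inv_symm (h : IsCoordMetric S G) (hy : y ∈ S) (i j : Fin n) :
    (G y)⁻¹ i j = (G y)⁻¹ j i :=
  congrFun (congrFun (h.inv_transpose_eq hy) j) i

theorem mul_inv (h : IsCoordMetric S G) (hy : y ∈ S) : G y * (G y)⁻¹ = 1 :=
  Matrix.mul_nonsing_inv _ (h.isUnit_det hy)

theorem inv_mul (h : IsCoordMetric S G) (hy : y ∈ S) : (G y)⁻¹ * G y = 1 :=
  Matrix.nonsing_inv_mul _ (h.isUnit_det hy)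

theorem smooth_inv (h : IsCoordMetric S G) : SmoothMat S (fun z => (G z)⁻¹) :=
  contDiffOn_matrix_inv h.smooth fun _ hz => (h.isUnit_det hz).ne_zero

end IsCoordMetric

/-- The matrix `(Γ^k_{ij})_{k,j}` of the connection form in the direction `i`. -/
def connMat (S : Set (EuclideanSpace ℝ (Fin n)))
    (G : EuclideanSpace ℝ (Fin n) → Matrix (Fin n) (Fin n) ℝ) (i : Fin n)
    (y : EuclideanSpace ℝ (Fin n)) : Matrix (Fin n) (Fin n) ℝ :=
  Matrix.of fun k j => christoffel S G k i j y

/-- The matrix `(R^l_{ijk})_{l,k}` of the curvature form. -/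
def curvMat (S : Set (EuclideanSpace ℝ (Fin n)))
    (G : EuclideanSpace ℝ (Fin n) → Matrix (Fin n) (Fin n) ℝ) (i j : Fin n)
    (y : EuclideanSpace ℝ (Fin n)) : Matrix (Fin n) (Fin n) ℝ :=
  pdMat S i (connMat S G j) y - pdMat S j (connMat S G i) y
    + (connMat S G i y * connMat S G j y - connMat S G j y * connMat S G i y)

/-- The matrix `(∇_m R^l_{ijk})_{l,k}`. -/
def covCurvMat (S : Set (EuclideanSpace ℝ (Fin n)))
    (G : EuclideanSpace ℝ (Fin n) → Matrix (Fin n) (Fin n) ℝ) (m i j : Fin n)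
    (y : EuclideanSpace ℝ (Fin n)) : Matrix (Fin n) (Fin n) ℝ :=
  pdMat S m (curvMat S G i j) y
    + (connMat S G m y * curvMat S G i j y - curvMat S G i j y * connMat S G m y)
    - ∑ p, (christoffel S G p m i y • curvMat S G p j y
      + christoffel S G p m j y • curvMat S G i p y)

/-- The matrix of the Ricci tensor. -/
def ricciMat (S : Set (EuclideanSpace ℝ (Fin n)))
    (G : EuclideanSpace ℝ (Fin n) → Matrix (Fin n) (Fin n) ℝ)
    (y : EuclideanSpace ℝ (Fin n)) : Matrix (Fin n) (Fin n) ℝ :=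
  Matrix.of fun i j => ricci S G i j y

theorem curvMat_apply (l i j k : Fin n) : curvMat S G i j y l k = riemann S G l i j k y := by
  simp [curvMat, riemann, pdMat, connMat, Matrix.mul_apply, Finset.sum_sub_distrib]

theorem ricci_eq_sum_curvMat (j k : Fin n) : ricci S G j k y = ∑ i, curvMat S G i j y i k := by
  simp [ricci, curvMat_apply]

namespace IsCoordMetric

theorem smooth_christoffel (h : IsCoordMetric S G) (k i j : Fin n) :
    ContDiffOn ℝ ∞ (christoffel S G k i j) S :=
  contDiffOn_const.mul (ContDiffOn.sum fun l _ => (h.smooth_inv k l).mul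
    (((contDiffOn_pd h.uniqueDiffOn i (h.smooth j l)).add
      (contDiffOn_pd h.uniqueDiffOn j (h.smooth i l))).sub
      (contDiffOn_pd h.uniqueDiffOn l (h.smooth i j))))

theorem smooth_connMat (h : IsCoordMetric S G) (i : Fin n) : SmoothMat S (connMat S G i) :=
  fun k j => h.smooth_christoffel k i j

theorem smooth_curvMat (h : IsCoordMetric S G) (i j : Fin n) : SmoothMat S (curvMat S G i j) :=
  (((h.smooth_connMat j).pdMat h.uniqueDiffOn i).sub
    ((h.smooth_connMat i).pdMat h.uniqueDiffOn j)).add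
    (((h.smooth_connMat i).mul (h.smooth_connMat j)).sub
      ((h.smooth_connMat j).mul (h.smooth_connMat i)))

theorem smooth_ricci (h : IsCoordMetric S G) (j k : Fin n) : ContDiffOn ℝ ∞ (ricci S G j k) S := by
  have : ricci S G j k = fun y => ∑ i, curvMat S G i j y i k :=
    funext fun y => ricci_eq_sum_curvMat j k
  rw [this]
  exact ContDiffOn.sum fun i _ => h.smooth_curvMat i j i k

theorem christoffel_symm (h : IsCoordMetric S G) (hy : y ∈ S) (k i j : Fin n) :
    christoffel S G k i j y = christoffel S G k j i y := by
  unfold christoffel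
  congr 1
  refine Finset.sum_congr rfl fun l _ => ?_
  rw [pd_congr (f := fun z => G z i j) (g := fun z => G z j i) (fun z hz => h.symm hz i j) hy]
  ring

theorem sum_mul_christoffel (h : IsCoordMetric S G) (hy : y ∈ S) (l i j : Fin n) :
    ∑ k, G y l k * christoffel S G k i j y = (1 / 2) * (pd S i (fun z => G z j l) y
      + pd S j (fun z => G z i l) y - pd S l (fun z => G z i j) y) := by
  set v : Fin n → ℝ := fun l => pd S i (fun z => G z j l) y
      + pd S j (fun z => G z i l) y - pd S l (fun z => G z i j) y
  have : (fun k => christoffel S G k i j y) = (1 / 2 : ℝ) • ((G y)⁻¹.mulVec v) := rfl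
  change (G y).mulVec (fun k => christoffel S G k i j y) l = (1 / 2 : ℝ) * v l
  rw [this, Matrix.mulVec_smul, Matrix.mulVec_mulVec, h.mul_inv hy, Matrix.one_mulVec]
  rfl

/-- The metric is parallel. -/
theorem pdMat_metric (h : IsCoordMetric S G) (hy : y ∈ S) (m : Fin n) :
    pdMat S m G y = (connMat S G m y).transpose * G y + G y * connMat S G m y := by
  ext i j
  have e1 : ((connMat S G m y).transpose * G y) i j = ∑ k, G y j k * christoffel S G k m i y := by
    simp only [Matrix.mul_apply, Matrix.transpose_apply, connMat, Matrix.of_apply]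
    exact Finset.sum_congr rfl fun k _ => by rw [h.symm hy k j]; ring
  have e2 : (G y * connMat S G m y) i j = ∑ k, G y i k * christoffel S G k m j y := rfl
  have hs : ∀ a b c : Fin n, pd S a (fun z => G z b c) y = pd S a (fun z => G z c b) y :=
    fun a b c => pd_congr (fun z hz => h.symm hz b c) hy a
  rw [Matrix.add_apply, e1, e2, h.sum_mul_christoffel hy, h.sum_mul_christoffel hy]
  simp only [pdMat, Matrix.of_apply]
  rw [hs m j i]
  ring

theorem pd_metric (h : IsCoordMetric S G) (hy : y ∈ S) (m i j : Fin n) :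
    pd S m (fun z => G z i j) y = ∑ k, christoffel S G k m i y * G y k j
      + ∑ k, G y i k * christoffel S G k m j y :=
  congrFun (congrFun (h.pdMat_metric hy m) i) j

/-- Obtained by differentiating `g⁻¹ g = 1` and using that the metric is parallel; it says that the
inverse metric is parallel too. -/
theorem pdMat_inv (h : IsCoordMetric S G) (hy : y ∈ S) (m : Fin n) :
    pdMat S m (fun z => (G z)⁻¹) y
      = -(connMat S G m y * (G y)⁻¹ + (G y)⁻¹ * (connMat S G m y).transpose) := by
  have h1 : pdMat S m (fun z => (G z)⁻¹ * G z) y = 0 := by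
    rw [pdMat_congr (B := fun _ => 1) (fun z hz => h.inv_mul hz) hy]
    ext k l
    simp [pdMat, pd_const]
  rw [pdMat_mul h.uniqueDiffOn h.smooth_inv h.smooth hy, h.pdMat_metric hy] at h1
  have h2 := congrArg (fun X => X * (G y)⁻¹) h1
  simp only [add_mul, zero_mul, mul_add, mul_assoc, h.mul_inv hy, mul_one] at h2
  rw [← mul_assoc (G y)⁻¹ (G y), h.inv_mul hy, one_mul] at h2
  rw [eq_neg_iff_add_eq_zero, ← h2]
  abel

theorem pd_inv (h : IsCoordMetric S G) (hy : y ∈ S) (m i j : Fin n) :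
    pd S m (fun z => (G z)⁻¹ i j) y = -(∑ k, christoffel S G i m k y * (G y)⁻¹ k j
      + ∑ k, (G y)⁻¹ i k * christoffel S G j m k y) :=
  congrFun (congrFun (h.pdMat_inv hy m) i) j

theorem curvMat_swap (i j : Fin n) : curvMat S G j i y = -curvMat S G i j y := by
  unfold curvMat
  abel

theorem covCurvMat_swap (h : IsCoordMetric S G) (hy : y ∈ S) (m i j : Fin n) :
    covCurvMat S G m j i y = -covCurvMat S G m i j y := by
  have h1 : pdMat S m (curvMat S G j i) y = -pdMat S m (curvMat S G i j) y := by
    have h0 : pdMat S m (fun z => curvMat S G j i z + curvMat S G i j z) y = 0 := by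
      rw [pdMat_congr (B := fun _ => 0) (fun z hz => by simp [curvMat_swap i j]) hy]
      ext k l
      simp [pdMat, pd_const]
    rw [pdMat_add h.uniqueDiffOn (h.smooth_curvMat j i) (h.smooth_curvMat i j) hy] at h0
    exact eq_neg_of_add_eq_zero_left h0
  have h2 : ∑ p, (christoffel S G p m j y • curvMat S G p i y
      + christoffel S G p m i y • curvMat S G j p y)
      = -∑ p, (christoffel S G p m i y • curvMat S G p j y
      + christoffel S G p m j y • curvMat S G i p y) := by
    rw [← Finset.sum_neg_distrib]
    refine Finset.sum_congr rfl fun p _ => ?_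
    rw [curvMat_swap i p, curvMat_swap p j]
    simp only [smul_neg]
    abel
  unfold covCurvMat
  rw [h1, h2, curvMat_swap i j]
  noncomm_ring

/-- The curvature endomorphisms are skew. -/
theorem curvMat_skew (h : IsCoordMetric S G) (hy : y ∈ S) (i j : Fin n) :
    (curvMat S G i j y).transpose * G y + G y * curvMat S G i j y = 0 := by
  -- Apply `∂_i` to the parallelism of `g`. Antisymmetrizing in `i, j` kills the left side, and the
  -- right side becomes the skewness expression for the curvature.
  have hd : ∀ i j, pdMat S i (pdMat S j G) y
      = (pdMat S i (connMat S G j) y).transpose * G y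
        + (connMat S G j y).transpose
          * ((connMat S G i y).transpose * G y + G y * connMat S G i y)
        + (((connMat S G i y).transpose * G y + G y * connMat S G i y) * connMat S G j y
          + G y * pdMat S i (connMat S G j) y) := by
    intro i j
    rw [pdMat_congr (fun z hz => h.pdMat_metric hz j) hy,
      pdMat_add h.uniqueDiffOn ((h.smooth_connMat j).transpose.mul h.smooth)
        (h.smooth.mul (h.smooth_connMat j)) hy,
      pdMat_mul h.uniqueDiffOn (h.smooth_connMat j).transpose h.smooth hy,
      pdMat_mul h.uniqueDiffOn h.smooth (h.smooth_connMat j) hy, h.pdMat_metric hy,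
      pdMat_transpose]
  have hc := pdMat_comm h.uniqueDiffOn h.subset_closure h.smooth hy i j
  rw [hd, hd] at hc
  simp only [curvMat, Matrix.transpose_add, Matrix.transpose_sub, Matrix.transpose_mul]
  rw [← sub_eq_zero] at hc
  rw [← hc]
  noncomm_ring

/-- The covariant derivative of `curvMat_skew`: its partial derivative is corrected by multiples of
the same identity, through `hA`, `hB` for the matrix indices and `hsum` for the form indices. -/
theorem covCurvMat_skew (h : IsCoordMetric S G) (hy : y ∈ S) (m i j : Fin n) :
    (covCurvMat S G m i j y).transpose * G y + G y * covCurvMat S G m i j y = 0 := by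
  have h1 : pdMat S m (fun z => (curvMat S G i j z).transpose * G z
      + G z * curvMat S G i j z) y = 0 := by
    rw [pdMat_congr (B := fun _ => 0) (fun z hz => h.curvMat_skew hz i j) hy]
    ext k l
    simp [pdMat, pd_const]
  have hF := h.smooth_curvMat i j
  rw [pdMat_add h.uniqueDiffOn (hF.transpose.mul h.smooth) (h.smooth.mul hF) hy,
    pdMat_mul h.uniqueDiffOn hF.transpose h.smooth hy,
    pdMat_mul h.uniqueDiffOn h.smooth hF hy, h.pdMat_metric hy, pdMat_transpose] at h1
  have hE := h.curvMat_skew hy i j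
  have hA : (connMat S G m y).transpose * ((curvMat S G i j y).transpose * G y
      + G y * curvMat S G i j y) = 0 := by rw [hE, mul_zero]
  have hB : ((curvMat S G i j y).transpose * G y
      + G y * curvMat S G i j y) * connMat S G m y = 0 := by rw [hE, zero_mul]
  have hsum : (∑ p, (christoffel S G p m i y • curvMat S G p j y
      + christoffel S G p m j y • curvMat S G i p y)).transpose * G y
      + G y * ∑ p, (christoffel S G p m i y • curvMat S G p j y
      + christoffel S G p m j y • curvMat S G i p y) = 0 := by
    rw [Matrix.transpose_sum, Finset.sum_mul, Finset.mul_sum, ← Finset.sum_add_distrib]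
    refine Finset.sum_eq_zero fun p _ => ?_
    have e1 := congrArg (fun X => christoffel S G p m i y • X) (h.curvMat_skew hy p j)
    have e2 := congrArg (fun X => christoffel S G p m j y • X) (h.curvMat_skew hy i p)
    simp only [smul_add, smul_zero] at e1 e2
    simp only [Matrix.transpose_add, Matrix.transpose_smul, add_mul, mul_add, Matrix.smul_mul,
      Matrix.mul_smul]
    rw [add_add_add_comm, e1, e2, add_zero]
  simp only [covCurvMat, Matrix.transpose_add, Matrix.transpose_sub, Matrix.transpose_mul]
  rw [sub_mul, mul_sub]
  have : ∀ a b c d : Matrix (Fin n) (Fin n) ℝ, b + d = 0 → a - b + (c - d) = a + c := by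
    intro a b c d hbd
    rw [sub_add_sub_comm, hbd, sub_zero]
  rw [this _ _ _ _ hsum]
  have h3 := congrArg₂ (fun X Y => X - Y) h1 (congrArg₂ (fun X Y => X + Y) hA hB)
  simp only [add_zero, sub_zero] at h3
  rw [← h3]
  noncomm_ring

/-- The second Bianchi identity. -/
theorem bianchi (h : IsCoordMetric S G) (hy : y ∈ S) (m i j : Fin n) :
    covCurvMat S G m i j y + covCurvMat S G i j m y + covCurvMat S G j m i y = 0 := by
  have hd : ∀ m i j, pdMat S m (curvMat S G i j) y
      = pdMat S m (pdMat S i (connMat S G j)) y - pdMat S m (pdMat S j (connMat S G i)) y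
        + (pdMat S m (connMat S G i) y * connMat S G j y
            + connMat S G i y * pdMat S m (connMat S G j) y
          - (pdMat S m (connMat S G j) y * connMat S G i y
            + connMat S G j y * pdMat S m (connMat S G i) y)) := by
    intro m i j
    have hA := h.smooth_connMat
    have hu := h.uniqueDiffOn
    unfold curvMat
    rw [pdMat_add hu (((hA j).pdMat hu i).sub ((hA i).pdMat hu j))
        (((hA i).mul (hA j)).sub ((hA j).mul (hA i))) hy,
      pdMat_sub hu ((hA j).pdMat hu i) ((hA i).pdMat hu j) hy,
      pdMat_sub hu ((hA i).mul (hA j)) ((hA j).mul (hA i)) hy,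
      pdMat_mul hu (hA i) (hA j) hy, pdMat_mul hu (hA j) (hA i) hy]
  have hc : ∀ m i j, pdMat S m (pdMat S i (connMat S G j)) y
      = pdMat S i (pdMat S m (connMat S G j)) y := fun m i j =>
    pdMat_comm h.uniqueDiffOn h.subset_closure (h.smooth_connMat j) hy m i
  -- The corrections for the form indices cancel in pairs, since the connection is torsion-free and
  -- the curvature alternates. What is left is the Bianchi identity for the curvature form.
  have hsum : (∑ p, (christoffel S G p m i y • curvMat S G p j y
      + christoffel S G p m j y • curvMat S G i p y))
      + (∑ p, (christoffel S G p i j y • curvMat S G p m y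
      + christoffel S G p i m y • curvMat S G j p y))
      + (∑ p, (christoffel S G p j m y • curvMat S G p i y
      + christoffel S G p j i y • curvMat S G m p y)) = 0 := by
    rw [← Finset.sum_add_distrib, ← Finset.sum_add_distrib]
    refine Finset.sum_eq_zero fun p _ => ?_
    rw [h.christoffel_symm hy p i m, h.christoffel_symm hy p j m, h.christoffel_symm hy p j i,
      curvMat_swap p j, curvMat_swap p i, curvMat_swap p m]
    simp only [smul_neg]
    abel
  have h0 : ∀ a b c x y z : Matrix (Fin n) (Fin n) ℝ, x + y + z = 0 → a + b + c = 0 →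
      a - x + (b - y) + (c - z) = 0 := by
    intro a b c x y z h1 h2
    rw [sub_add_sub_comm, sub_add_sub_comm, h1, h2, sub_zero]
  unfold covCurvMat
  refine h0 _ _ _ _ _ _ hsum ?_
  rw [hd m i j, hd i j m, hd j m i, hc m i j, hc m j i, hc i j m]
  simp only [curvMat]
  noncomm_ring

/-- Covariant differentiation commutes with contraction: the corrections for the upper index and for
the contracted lower index `i` cancel. -/
theorem sum_covCurvMat (h : IsCoordMetric S G) (hy : y ∈ S) (m j k : Fin n) :
    ∑ i, covCurvMat S G m i j y i k = covRicci S G m j k y := by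
  have h1 : pd S m (ricci S G j k) y = ∑ i, pdMat S m (curvMat S G i j) y i k :=
    (pd_congr (fun z _ => ricci_eq_sum_curvMat j k) hy m).trans
      (pd_sum h.uniqueDiffOn (fun i => h.smooth_curvMat i j i k) hy m)
  have h2 : ∑ i, (connMat S G m y * curvMat S G i j y) i k
      = ∑ i, ∑ p, christoffel S G p m i y * curvMat S G p j y i k := by
    simp only [Matrix.mul_apply]
    rw [Finset.sum_comm]
    refine Finset.sum_congr rfl fun p _ => Finset.sum_congr rfl fun i _ => ?_
    simp [connMat]
  have h3 : ∑ i, (curvMat S G i j y * connMat S G m y) i k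
      = ∑ p, christoffel S G p m k y * ricci S G j p y := by
    simp only [Matrix.mul_apply, ricci_eq_sum_curvMat, Finset.mul_sum]
    rw [Finset.sum_comm]
    refine Finset.sum_congr rfl fun p _ => Finset.sum_congr rfl fun i _ => ?_
    simp [connMat, mul_comm]
  have h4 : ∑ i, ∑ p, christoffel S G p m j y * curvMat S G i p y i k
      = ∑ p, christoffel S G p m j y * ricci S G p k y := by
    simp only [ricci_eq_sum_curvMat, Finset.mul_sum]
    rw [Finset.sum_comm]
  simp only [covCurvMat, covRicci, Matrix.sub_apply, Matrix.add_apply, Matrix.sum_apply,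
    Matrix.smul_apply, smul_eq_mul, Finset.sum_add_distrib, Finset.sum_sub_distrib]
  rw [h1, h2, h3, h4]
  ring

end IsCoordMetric

end Curvature

/-! ### The gradient of the scalar curvature and the contracted Bianchi identity. -/

section ScalarCurvature

variable {n : ℕ} {S : Set (EuclideanSpace ℝ (Fin n))} {y : EuclideanSpace ℝ (Fin n)}
  {G : EuclideanSpace ℝ (Fin n) → Matrix (Fin n) (Fin n) ℝ}

/-- The trace of `N g⁻¹` over a family of skew endomorphisms. -/
theorem sum_inv_mul_of_skew {g gi : Matrix (Fin n) (Fin n) ℝ} (hgi : gi.transpose = gi)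
    (h1 : g * gi = 1) (h2 : gi * g = 1) {N : Matrix (Fin n) (Fin n) ℝ}
    (hN : N.transpose * g + g * N = 0) (i j : Fin n) :
    ∑ k, gi j k * N i k = -∑ k, gi i k * N j k := by
  have h3 : gi * N.transpose + N * gi = 0 := by
    have := congrArg (fun X => gi * X * gi) hN
    simp only [mul_add, add_mul, mul_zero, zero_mul] at this
    rwa [← mul_assoc, mul_assoc (gi * N.transpose), h1, mul_one, ← mul_assoc gi g, h2, one_mul]
      at this
  have h4 := congrFun (congrFun h3 j) i
  have hs : ∀ a b, gi a b = gi b a := fun a b => congrFun (congrFun hgi b) a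
  simp only [Matrix.add_apply, Matrix.mul_apply, Matrix.transpose_apply, Matrix.zero_apply] at h4
  rw [eq_neg_iff_add_eq_zero, ← h4]
  congr 1
  exact Finset.sum_congr rfl fun k _ => by rw [hs i k, mul_comm]

namespace IsCoordMetric

theorem sum_mul_inv (h : IsCoordMetric S G) (hy : y ∈ S) (i j : Fin n) :
    ∑ k, G y i k * (G y)⁻¹ k j = if i = j then 1 else 0 := by
  rw [← Matrix.mul_apply, h.mul_inv hy, Matrix.one_apply]

theorem pd_ricci (m i j : Fin n) : pd S m (ricci S G i j) y = covRicci S G m i j y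
    + ∑ l, christoffel S G l m i y * ricci S G l j y
    + ∑ l, christoffel S G l m j y * ricci S G i l y := by
  simp only [covRicci, Finset.sum_add_distrib]
  ring

/-- `∂_m R = g^{ij} ∇_m R_{ij}`. -/
theorem pd_scalarCurv (h : IsCoordMetric S G) (hy : y ∈ S) (m : Fin n) :
    pd S m (scalarCurv S G) y = ∑ i, ∑ j, (G y)⁻¹ i j * covRicci S G m i j y := by
  have hsm : ∀ i j, ContDiffOn ℝ ∞ (fun z => (G z)⁻¹ i j * ricci S G i j z) S :=
    fun i j => (h.smooth_inv i j).mul (h.smooth_ricci i j)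
  have h1 : pd S m (scalarCurv S G) y = ∑ i, ∑ j, (pd S m (fun z => (G z)⁻¹ i j) y
      * ricci S G i j y + (G y)⁻¹ i j * pd S m (ricci S G i j) y) := by
    unfold scalarCurv
    rw [pd_sum h.uniqueDiffOn (fun i => ContDiffOn.sum fun j _ => hsm i j) hy]
    refine Finset.sum_congr rfl fun i _ => ?_
    rw [pd_sum h.uniqueDiffOn (hsm i) hy]
    exact Finset.sum_congr rfl fun j _ =>
      pd_mul h.uniqueDiffOn (h.smooth_inv i j) (h.smooth_ricci i j) hy m
  rw [h1]
  simp only [h.pd_inv hy, pd_ricci, neg_mul, mul_add, add_mul, neg_add, Finset.sum_add_distrib,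
    Finset.sum_neg_distrib, Finset.sum_mul, Finset.mul_sum]
  have e1 : ∑ i, ∑ j, ∑ k, christoffel S G i m k y * (G y)⁻¹ k j * ricci S G i j y
      = ∑ i, ∑ j, ∑ k, (G y)⁻¹ i j * (christoffel S G k m i y * ricci S G k j y) := by
    rw [Finset.sum_congr rfl fun i _ => Finset.sum_comm, Finset.sum_comm]
    refine Finset.sum_congr rfl fun k _ => ?_
    rw [Finset.sum_comm]
    exact Finset.sum_congr rfl fun j _ => Finset.sum_congr rfl fun i _ => by ring
  have e2 : ∑ i, ∑ j, ∑ k, (G y)⁻¹ i k * christoffel S G j m k y * ricci S G i j y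
      = ∑ i, ∑ j, ∑ k, (G y)⁻¹ i j * (christoffel S G k m j y * ricci S G i k y) := by
    refine Finset.sum_congr rfl fun i _ => ?_
    rw [Finset.sum_comm]
    exact Finset.sum_congr rfl fun j _ => Finset.sum_congr rfl fun k _ => by ring
  rw [e1, e2]
  ring

/-- The contracted second Bianchi identity `∂_m R = 2 g^{ij} ∇_i R_{jm}`. -/
theorem contracted_bianchi (h : IsCoordMetric S G) (hy : y ∈ S) (m : Fin n) :
    ∑ i, ∑ j, (G y)⁻¹ i j * covRicci S G m i j y
      = 2 * ∑ i, ∑ j, (G y)⁻¹ i j * covRicci S G i m j y := by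
  -- First contraction of the Bianchi identity, over the upper index and the form index `i`.
  have h1 : ∀ j k, covRicci S G m j k y + ∑ i, covCurvMat S G i j m y i k
      - covRicci S G j m k y = 0 := by
    intro j k
    have h2 : ∀ i, covCurvMat S G j m i y i k = -covCurvMat S G j i m y i k := fun i => by
      rw [h.covCurvMat_swap hy]; rfl
    rw [← h.sum_covCurvMat hy m j k, ← h.sum_covCurvMat hy j m k, sub_eq_add_neg,
      ← Finset.sum_neg_distrib, ← Finset.sum_congr rfl fun i _ => h2 i,
      ← Finset.sum_add_distrib, ← Finset.sum_add_distrib]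
    exact Finset.sum_eq_zero fun i _ => congrFun (congrFun (h.bianchi hy m i j) i) k
  -- Second contraction: skewness of `∇R` exchanges the raised index with the upper one, turning the
  -- divergence of the curvature into minus the divergence of Ricci.
  have h2 : ∑ j, ∑ k, (G y)⁻¹ j k * ∑ i, covCurvMat S G i j m y i k
      = -∑ i, ∑ k, (G y)⁻¹ i k * covRicci S G i m k y := by
    simp only [← h.sum_covCurvMat hy, Finset.mul_sum]
    rw [← Finset.sum_neg_distrib]
    rw [Finset.sum_congr rfl fun j _ => Finset.sum_comm, Finset.sum_comm]
    refine Finset.sum_congr rfl fun i _ => ?_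
    rw [Finset.sum_comm (s := Finset.univ (α := Fin n)) (t := Finset.univ (α := Fin n))
      (f := fun k j => (G y)⁻¹ i k * covCurvMat S G i j m y j k), ← Finset.sum_neg_distrib]
    exact Finset.sum_congr rfl fun j _ => sum_inv_mul_of_skew (h.inv_transpose_eq hy)
      (h.mul_inv hy) (h.inv_mul hy) (h.covCurvMat_skew hy i j m) i j
  have h3 : ∑ j, ∑ k, (G y)⁻¹ j k * (covRicci S G m j k y + ∑ i, covCurvMat S G i j m y i k
      - covRicci S G j m k y) = 0 :=
    Finset.sum_eq_zero fun j _ => Finset.sum_eq_zero fun k _ => by rw [h1, mul_zero]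
  simp only [mul_sub, mul_add, Finset.sum_sub_distrib, Finset.sum_add_distrib] at h3
  rw [h2] at h3
  linarith

end IsCoordMetric

end ScalarCurvature

/-! ### Geometry of an umbilic boundary at a fixed time. -/

section Boundary

variable {n : ℕ} [NeZero n] {S : Set (EuclideanSpace ℝ (Fin n))} {y : EuclideanSpace ℝ (Fin n)}
  {G : EuclideanSpace ℝ (Fin n) → Matrix (Fin n) (Fin n) ℝ}

/-- The length `√g^{00}` of `dx⁰`. -/
def conormalLength (G : EuclideanSpace ℝ (Fin n) → Matrix (Fin n) (Fin n) ℝ)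
    (y : EuclideanSpace ℝ (Fin n)) : ℝ := √((G y)⁻¹ 0 0)

/-- The tangential part `g^{ij} - ν^i ν^j` of the inverse metric. -/
def tangentialInv (G : EuclideanSpace ℝ (Fin n) → Matrix (Fin n) (Fin n) ℝ)
    (y : EuclideanSpace ℝ (Fin n)) (i j : Fin n) : ℝ :=
  (G y)⁻¹ i j - (G y)⁻¹ i 0 * (G y)⁻¹ 0 j / (G y)⁻¹ 0 0

/-- The contraction `R_{il} g^{l0}`. -/
def ricciConormal (S : Set (EuclideanSpace ℝ (Fin n)))
    (G : EuclideanSpace ℝ (Fin n) → Matrix (Fin n) (Fin n) ℝ) (i : Fin n)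
    (y : EuclideanSpace ℝ (Fin n)) : ℝ :=
  ∑ l, ricci S G i l y * (G y)⁻¹ l 0

theorem sum_eq_of_tangential {a X Y : Fin n → Fin n → ℝ} (ha : ∀ i, a i 0 = 0)
    (ha' : ∀ i, a 0 i = 0) (h : ∀ i j, i ≠ 0 → j ≠ 0 → X i j = Y i j) :
    ∑ i, ∑ j, a i j * X i j = ∑ i, ∑ j, a i j * Y i j := by
  refine Finset.sum_congr rfl fun i _ => Finset.sum_congr rfl fun j _ => ?_
  by_cases hi : i = 0
  · simp [hi, ha']
  by_cases hj : j = 0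
  · simp [hj, ha]
  rw [h i j hi hj]

namespace IsCoordMetric

theorem inv_zero_zero_pos (h : IsCoordMetric S G) (hy : y ∈ S) : 0 < (G y)⁻¹ 0 0 :=
  (h.posDef y hy).inv.diag_pos

theorem conormalLength_pos (h : IsCoordMetric S G) (hy : y ∈ S) : 0 < conormalLength G y :=
  Real.sqrt_pos.2 (h.inv_zero_zero_pos hy)

theorem conormalLength_mul_self (h : IsCoordMetric S G) (hy : y ∈ S) :
    conormalLength G y * conormalLength G y = (G y)⁻¹ 0 0 :=
  Real.mul_self_sqrt (h.inv_zero_zero_pos hy).le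

theorem smooth_conormalLength (h : IsCoordMetric S G) : ContDiffOn ℝ ∞ (conormalLength G) S :=
  (h.smooth_inv 0 0).sqrt fun _ hz => (h.inv_zero_zero_pos hz).ne'

theorem smooth_normal (h : IsCoordMetric S G) (i : Fin n) : ContDiffOn ℝ ∞ (normal G i) S :=
  (h.smooth_inv i 0).neg.div h.smooth_conormalLength fun _ hz => (h.conormalLength_pos hz).ne'

theorem tangentialInv_zero_left (h : IsCoordMetric S G) (hy : y ∈ S) (j : Fin n) :
    tangentialInv G y 0 j = 0 := by
  have := (h.inv_zero_zero_pos hy).ne'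
  simp only [tangentialInv]
  field_simp
  ring

theorem tangentialInv_zero_right (h : IsCoordMetric S G) (hy : y ∈ S) (i : Fin n) :
    tangentialInv G y i 0 = 0 := by
  have := (h.inv_zero_zero_pos hy).ne'
  simp only [tangentialInv]
  field_simp
  ring

/-- The tangential part of `g⁻¹` vanishes when an index is `0`, so its product with the full matrix
`g` only sees the tangential block, where it is the identity. -/
theorem bdryMetric_inv (h : IsCoordMetric S G) (hy : y ∈ S) (α β : {i : Fin n // i ≠ 0}) :
    (bdryMetric G y)⁻¹ α β = tangentialInv G y α β := by
  have : (bdryMetric G y)⁻¹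
      = Matrix.of fun α β : {i : Fin n // i ≠ 0} => tangentialInv G y α β := by
    refine Matrix.inv_eq_right_inv ?_
    ext α β
    have h1 : ∑ k, G y α k * tangentialInv G y k β = if (α : Fin n) = β then 1 else 0 := by
      have e : ∀ k, G y α k * tangentialInv G y k β = G y α k * (G y)⁻¹ k β
          - G y α k * (G y)⁻¹ k 0 * ((G y)⁻¹ 0 β / (G y)⁻¹ 0 0) := fun k => by
        simp only [tangentialInv]; ring
      simp only [e, Finset.sum_sub_distrib, ← Finset.sum_mul, h.sum_mul_inv hy, α.2, if_false]
      ring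
    rw [Fintype.sum_eq_add_sum_subtype_ne _ (0 : Fin n), h.tangentialInv_zero_left hy, mul_zero,
      zero_add] at h1
    simp only [Matrix.mul_apply, bdryMetric, Matrix.submatrix_apply, Matrix.of_apply,
      Matrix.one_apply, h1, Subtype.ext_iff]
  rw [this]
  rfl

theorem tangentialTraceRicci_eq (h : IsCoordMetric S G) (hy : y ∈ S) :
    tangentialTraceRicci S G y = ∑ i, ∑ j, tangentialInv G y i j * ricci S G i j y := by
  unfold tangentialTraceRicci
  rw [Fintype.sum_eq_add_sum_subtype_ne _ (0 : Fin n)]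
  simp only [h.tangentialInv_zero_left hy, zero_mul, Finset.sum_const_zero, zero_add]
  refine Finset.sum_congr rfl fun α _ => ?_
  rw [Fintype.sum_eq_add_sum_subtype_ne _ (0 : Fin n)]
  simp only [h.tangentialInv_zero_right hy, zero_mul, zero_add, h.bdryMetric_inv hy]

/-- `h_{αβ} = Γ^0_{αβ} / √g^{00}`. -/
theorem secondFF_eq (h : IsCoordMetric S G) (hy : y ∈ S) (α : Fin n) {β : Fin n} (hβ : β ≠ 0) :
    secondFF S G α β y = christoffel S G 0 α β y / conormalLength G y := by
  -- Lowering the index of `ν` gives `-dx⁰ / w`. The field is defined on all of `S`, so `g(ν, ∂_β) =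
  -- 0` may be differentiated there.
  have hν : ∀ z ∈ S, ∀ i, ∑ j, G z j i * normal G j z
      = -(if i = 0 then 1 else 0) / conormalLength G z := by
    intro z hz i
    rw [← h.sum_mul_inv hz i 0, ← Finset.sum_neg_distrib, Finset.sum_div]
    refine Finset.sum_congr rfl fun j _ => ?_
    rw [h.symm hz j i]
    simp only [normal, conormalLength]
    ring
  have h1 : ∑ j, (pd S α (fun z => G z j β) y * normal G j y
      + G y j β * pd S α (normal G j) y) = 0 := by
    have h2 : pd S α (fun z => ∑ j, G z j β * normal G j z) y = 0 := by
      rw [pd_congr (g := fun _ => 0) (fun z hz => by simp [hν z hz, hβ]) hy, pd_const]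
    rw [pd_sum h.uniqueDiffOn (fun j => (h.smooth j β).mul (h.smooth_normal j)) hy] at h2
    rw [← h2]
    exact Finset.sum_congr rfl fun j _ =>
      (pd_mul h.uniqueDiffOn (h.smooth j β) (h.smooth_normal j) hy α).symm
  simp only [h.pd_metric hy, add_mul, Finset.sum_add_distrib] at h1
  simp only [secondFF, mul_add, Finset.sum_add_distrib]
  have e1 : ∑ j, (∑ k, christoffel S G k α j y * G y k β) * normal G j y
      = ∑ j, G y j β * ∑ k, christoffel S G j α k y * normal G k y := by
    simp only [Finset.sum_mul, Finset.mul_sum]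
    rw [Finset.sum_comm]
    exact Finset.sum_congr rfl fun j _ => Finset.sum_congr rfl fun k _ => by ring
  have e2 : ∑ j, (∑ k, G y j k * christoffel S G k α β y) * normal G j y
      = -(christoffel S G 0 α β y / conormalLength G y) := by
    have : ∀ k, ∑ j, G y j k * christoffel S G k α β y * normal G j y
        = christoffel S G k α β y * (-(if k = 0 then 1 else 0) / conormalLength G y) := by
      intro k
      rw [← hν y hy k, Finset.mul_sum]
      exact Finset.sum_congr rfl fun j _ => by ring
    simp only [Finset.sum_mul]
    rw [Finset.sum_comm]
    simp only [this]
    rw [Finset.sum_eq_single 0 (fun k _ hk => by simp [hk]) (by simp)]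
    simp
    ring
  rw [e1, e2] at h1
  linarith

end IsCoordMetric

/-- The boundary of the Riemannian metric `G` on the coordinate domain `S` is umbilic with
constant factor `κ`. -/
structure IsUmbilicMetric (κ : ℝ) (S : Set (EuclideanSpace ℝ (Fin n)))
    (G : EuclideanSpace ℝ (Fin n) → Matrix (Fin n) (Fin n) ℝ) : Prop extends
    IsCoordMetric S G where
  isRelOpen : ∃ U : Set (EuclideanSpace ℝ (Fin n)), IsOpen U ∧ S = U ∩ {z | 0 ≤ z 0}
  umbilic : ∀ z ∈ S, z 0 = 0 → ∀ α β : Fin n, α ≠ 0 → β ≠ 0 →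
    secondFF S G α β z = κ * G z α β

namespace IsUmbilicMetric

variable {κ : ℝ}

theorem christoffel_zero (h : IsUmbilicMetric κ S G) (hy : y ∈ S) (hy0 : y 0 = 0) {α β : Fin n}
    (hα : α ≠ 0) (hβ : β ≠ 0) :
    christoffel S G 0 α β y = κ * conormalLength G y * G y α β := by
  have h1 := h.umbilic y hy hy0 α β hα hβ
  rw [h.secondFF_eq hy α hβ, div_eq_iff (h.conormalLength_pos hy).ne'] at h1
  rw [h1]
  ring

/-- Isolates the one coefficient `Γ^0_{α0}` that the boundary condition does not determine. Its
defect from the umbilic form multiplies only `V 0`, and later uses arrange for it to cancel or for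
`V 0` to vanish. -/
theorem sum_christoffel_zero (h : IsUmbilicMetric κ S G) (hy : y ∈ S) (hy0 : y 0 = 0) {α : Fin n}
    (hα : α ≠ 0) (V : Fin n → ℝ) :
    ∑ m, christoffel S G 0 α m y * V m = κ * conormalLength G y * ∑ m, G y α m * V m
      + (christoffel S G 0 α 0 y - κ * conormalLength G y * G y α 0) * V 0 := by
  rw [Fintype.sum_eq_add_sum_subtype_ne _ (0 : Fin n),
    Fintype.sum_eq_add_sum_subtype_ne (fun m => G y α m * V m) (0 : Fin n)]
  have : ∑ m : {i : Fin n // i ≠ 0}, christoffel S G 0 α m y * V m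
      = κ * conormalLength G y * ∑ m : {i : Fin n // i ≠ 0}, G y α m * V m := by
    rw [Finset.mul_sum]
    exact Finset.sum_congr rfl fun m _ => by rw [h.christoffel_zero hy hy0 hα m.2]; ring
  rw [this]
  ring

/-- Differentiate `w² = g^{00}` and apply `sum_christoffel_zero` to `V^m = g^{m0}`; the metric term
is `δ_α^0 = 0`, so only the undetermined coefficient remains. -/
theorem pd_conormalLength (h : IsUmbilicMetric κ S G) (hy : y ∈ S) (hy0 : y 0 = 0) {α : Fin n}
    (hα : α ≠ 0) : pd S α (conormalLength G) y
      = -(christoffel S G 0 α 0 y - κ * conormalLength G y * G y α 0) * conormalLength G y := by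
  have h1 : pd S α (fun z => conormalLength G z * conormalLength G z) y
      = pd S α (fun z => (G z)⁻¹ 0 0) y :=
    pd_congr (fun z hz => h.conormalLength_mul_self hz) hy α
  have e : ∑ k, (G y)⁻¹ 0 k * christoffel S G 0 α k y
      = ∑ k, christoffel S G 0 α k y * (G y)⁻¹ k 0 :=
    Finset.sum_congr rfl fun k _ => by rw [h.inv_symm hy 0 k, mul_comm]
  rw [pd_mul h.uniqueDiffOn h.smooth_conormalLength h.smooth_conormalLength hy, h.pd_inv hy, e,
    h.sum_christoffel_zero hy hy0 hα, h.sum_mul_inv hy, if_neg hα,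
    ← h.conormalLength_mul_self hy] at h1
  refine mul_left_cancel₀ (h.conormalLength_pos hy).ne' ?_
  linear_combination h1 / 2

/-- The Codazzi equation `R^0_{αβγ} = 0` on an umbilic boundary. -/
theorem riemann_zero (h : IsUmbilicMetric κ S G) (hy : y ∈ S) (hy0 : y 0 = 0) {α β γ : Fin n}
    (hα : α ≠ 0) (hβ : β ≠ 0) (hγ : γ ≠ 0) : riemann S G 0 α β γ y = 0 := by
  obtain ⟨U, hU, hSU⟩ := h.isRelOpen
  have hw := contDiffOn_const (c := κ) |>.mul h.smooth_conormalLength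
  -- The umbilic form of `Γ^0_{bc}` holds only along the boundary, which suffices for a tangential
  -- derivative. The undetermined coefficient enters through `∂_a w` and cancels against the
  -- quadratic curvature terms.
  have hpd : ∀ {a b c : Fin n}, a ≠ 0 → b ≠ 0 → c ≠ 0 → pd S a (christoffel S G 0 b c) y
      = κ * pd S a (conormalLength G) y * G y b c
        + κ * conormalLength G y * (∑ k, G y c k * christoffel S G k a b y
          + ∑ k, G y b k * christoffel S G k a c y) := by
    intro a b c ha hb hc
    rw [pd_eq_of_eqOn_boundary (g := fun z => κ * conormalLength G z * G z b c) hU hSU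
      (h.smooth_christoffel 0 b c) (hw.mul (h.smooth b c))
      (fun z hz hz0 => h.christoffel_zero hz hz0 hb hc) hy hy0 ha,
      pd_mul h.uniqueDiffOn hw (h.smooth b c) hy,
      pd_mul h.uniqueDiffOn contDiffOn_const h.smooth_conormalLength hy, pd_const, h.pd_metric hy]
    have : ∑ k, christoffel S G k a b y * G y k c = ∑ k, G y c k * christoffel S G k a b y :=
      Finset.sum_congr rfl fun k _ => by rw [h.symm hy k c, mul_comm]
    rw [this]
    ring
  have hs : ∑ k, G y γ k * christoffel S G k α β y = ∑ k, G y γ k * christoffel S G k β α y :=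
    Finset.sum_congr rfl fun k _ => by rw [h.christoffel_symm hy k α β]
  rw [riemann, Finset.sum_sub_distrib, h.sum_christoffel_zero hy hy0 hα,
    h.sum_christoffel_zero hy hy0 hβ, hpd hα hβ hγ, hpd hβ hα hγ, hs,
    h.pd_conormalLength hy hy0 hα, h.pd_conormalLength hy hy0 hβ,
    h.christoffel_zero hy hy0 hβ hγ, h.christoffel_zero hy hy0 hα hγ]
  ring

/-- `R_{βν} = 0` on an umbilic boundary. -/
theorem ricciConormal_eq_zero (h : IsUmbilicMetric κ S G) (hy : y ∈ S) (hy0 : y 0 = 0)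
    {β : Fin n} (hβ : β ≠ 0) : ricciConormal S G β y = 0 := by
  have hsk : ∀ i a b, ∑ k, (G y)⁻¹ b k * curvMat S G i β y a k
      = -∑ k, (G y)⁻¹ a k * curvMat S G i β y b k := fun i a b =>
    sum_inv_mul_of_skew (h.inv_transpose_eq hy) (h.mul_inv hy) (h.inv_mul hy)
      (h.curvMat_skew hy i β) a b
  have h1 : ricciConormal S G β y = -∑ i, ∑ k, (G y)⁻¹ i k * curvMat S G i β y 0 k := by
    unfold ricciConormal
    simp only [ricci_eq_sum_curvMat, Finset.sum_mul]
    rw [Finset.sum_comm, ← Finset.sum_neg_distrib]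
    refine Finset.sum_congr rfl fun i _ => ?_
    rw [← hsk]
    exact Finset.sum_congr rfl fun k _ => by rw [h.inv_symm hy k 0, mul_comm]
  -- A skew form vanishes on the diagonal. Hence in `h3` the inverse metric may be replaced by its
  -- tangential part, and only the Codazzi components are left.
  have h2 : ∀ i, ∑ k, (G y)⁻¹ 0 k * curvMat S G i β y 0 k = 0 := fun i => by
    have := hsk i 0 0
    linarith
  have h3 : ∑ i, ∑ k, (G y)⁻¹ i k * curvMat S G i β y 0 k
      = ∑ i, ∑ k, tangentialInv G y i k * curvMat S G i β y 0 k := by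
    refine Finset.sum_congr rfl fun i _ => ?_
    have : ∀ k, tangentialInv G y i k * curvMat S G i β y 0 k
        = (G y)⁻¹ i k * curvMat S G i β y 0 k - (G y)⁻¹ i 0 / (G y)⁻¹ 0 0
          * ((G y)⁻¹ 0 k * curvMat S G i β y 0 k) := fun k => by
      simp only [tangentialInv]; ring
    simp only [this, Finset.sum_sub_distrib, ← Finset.mul_sum, h2]
    ring
  rw [h1, h3, sum_eq_of_tangential (Y := fun _ _ => 0) (h.tangentialInv_zero_right hy)
    (h.tangentialInv_zero_left hy)
    (fun i k hi hk => by rw [curvMat_apply, h.riemann_zero hy hy0 hi hβ hk])]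
  simp

/-- As the mixed components `R_{βν}` vanish, only `i = 0` survives in the outer sum, where `ν^0 =
-w`. -/
theorem ricciNN_eq (h : IsUmbilicMetric κ S G) (hy : y ∈ S) (hy0 : y 0 = 0) :
    ricciNN S G y = ricciConormal S G 0 y := by
  have hw := (h.conormalLength_pos hy).ne'
  have h1 : ∀ i, ∑ j, ricci S G i j y * normal G i y * normal G j y
      = normal G i y * (-(1 / conormalLength G y)) * ricciConormal S G i y := by
    intro i
    rw [ricciConormal, Finset.mul_sum]
    refine Finset.sum_congr rfl fun j _ => ?_
    simp only [normal, conormalLength]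
    ring
  simp only [ricciNN, h1]
  rw [Finset.sum_eq_single 0
    (fun i _ hi => by rw [h.ricciConormal_eq_zero hy hy0 hi, mul_zero]) (by simp)]
  have : normal G 0 y = -(conormalLength G y) := by
    change -((G y)⁻¹ 0 0) / conormalLength G y = _
    rw [← h.conormalLength_mul_self hy]
    field_simp
  rw [this]
  field_simp

/-- `g^{0l} ∇_α R_{βl}` on an umbilic boundary. -/
theorem sum_covRicci_tangential (h : IsUmbilicMetric κ S G) (hy : y ∈ S) (hy0 : y 0 = 0)
    {α β : Fin n} (hα : α ≠ 0) (hβ : β ≠ 0) :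
    ∑ l, (G y)⁻¹ 0 l * covRicci S G α β l y
      = κ * conormalLength G y * (ricci S G β α y - G y α β * ricciConormal S G 0 y) := by
  obtain ⟨U, hU, hSU⟩ := h.isRelOpen
  have hsm : ∀ l, ContDiffOn ℝ ∞ (fun z => ricci S G β l z * (G z)⁻¹ l 0) S :=
    fun l => (h.smooth_ricci β l).mul (h.smooth_inv l 0)
  -- `R_{βl} g^{l0}` vanishes along the whole boundary, hence so does its tangential derivative.
  -- Expanding it gives the covariant derivative plus connection terms, evaluated in `e2`, `e3`,
  -- `e4`.
  have h0 : pd S α (ricciConormal S G β) y = 0 := by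
    rw [pd_eq_of_eqOn_boundary (f := ricciConormal S G β) (g := fun _ => 0) hU hSU (ContDiffOn.sum fun l _ => hsm l)
      contDiffOn_const (fun z hz hz0 => h.ricciConormal_eq_zero hz hz0 hβ) hy hy0 hα, pd_const]
  have h1 : pd S α (ricciConormal S G β) y = ∑ l, (pd S α (ricci S G β l) y * (G y)⁻¹ l 0
      + ricci S G β l y * pd S α (fun z => (G z)⁻¹ l 0) y) := by
    unfold ricciConormal
    rw [pd_sum h.uniqueDiffOn hsm hy]
    exact Finset.sum_congr rfl fun l _ =>
      pd_mul h.uniqueDiffOn (h.smooth_ricci β l) (h.smooth_inv l 0) hy α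
  rw [h0] at h1
  simp only [IsCoordMetric.pd_ricci, h.pd_inv hy, add_mul, mul_add, mul_neg, neg_add,
    Finset.sum_add_distrib, Finset.sum_neg_distrib] at h1
  have e1 : ∑ l, covRicci S G α β l y * (G y)⁻¹ l 0
      = ∑ l, (G y)⁻¹ 0 l * covRicci S G α β l y :=
    Finset.sum_congr rfl fun l _ => by rw [h.inv_symm hy l 0, mul_comm]
  have e2 : ∑ l, (∑ m, christoffel S G m α β y * ricci S G m l y) * (G y)⁻¹ l 0
      = κ * conormalLength G y * G y α β * ricciConormal S G 0 y := by
    have : ∑ l, (∑ m, christoffel S G m α β y * ricci S G m l y) * (G y)⁻¹ l 0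
        = ∑ m, christoffel S G m α β y * ricciConormal S G m y := by
      simp only [ricciConormal, Finset.sum_mul, Finset.mul_sum]
      rw [Finset.sum_comm]
      exact Finset.sum_congr rfl fun j _ => Finset.sum_congr rfl fun k _ => by ring
    rw [this, Finset.sum_eq_single 0
      (fun i _ hi => by rw [h.ricciConormal_eq_zero hy hy0 hi, mul_zero]) (by simp),
      h.christoffel_zero hy hy0 hα hβ]
  have e3 : ∑ l, (∑ m, christoffel S G m α l y * ricci S G β m y) * (G y)⁻¹ l 0
      = ∑ l, ricci S G β l y * ∑ m, christoffel S G l α m y * (G y)⁻¹ m 0 := by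
    simp only [Finset.sum_mul, Finset.mul_sum]
    rw [Finset.sum_comm]
    exact Finset.sum_congr rfl fun j _ => Finset.sum_congr rfl fun k _ => by ring
  have e4 : ∑ l, ricci S G β l y * ∑ m, (G y)⁻¹ l m * christoffel S G 0 α m y
      = κ * conormalLength G y * ricci S G β α y := by
    -- With the index raised, `V 0` is the mixed component just shown to vanish, so the undetermined
    -- `Γ^0_{α0}` drops out.
    set V : Fin n → ℝ := fun m => ∑ l, ricci S G β l y * (G y)⁻¹ l m
    have e : ∑ l, ricci S G β l y * ∑ m, (G y)⁻¹ l m * christoffel S G 0 α m y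
        = ∑ m, christoffel S G 0 α m y * V m := by
      simp only [V, Finset.mul_sum]
      rw [Finset.sum_comm]
      exact Finset.sum_congr rfl fun j _ => Finset.sum_congr rfl fun k _ => by ring
    have hV0 : V 0 = 0 := h.ricciConormal_eq_zero hy hy0 hβ
    have hV : ∑ m, G y α m * V m = ricci S G β α y := by
      have : ∀ l, ∑ m, G y α m * (ricci S G β l y * (G y)⁻¹ l m)
          = ricci S G β l y * if α = l then 1 else 0 := by
        intro l
        rw [← h.sum_mul_inv hy α l, Finset.mul_sum]
        exact Finset.sum_congr rfl fun m _ => by rw [h.inv_symm hy l m]; ring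
      simp only [V, Finset.mul_sum]
      rw [Finset.sum_comm]
      simp [this]
    rw [e, h.sum_christoffel_zero hy hy0 hα, hV0, hV]
    ring
  rw [e1, e2, e3, e4] at h1
  linarith

end IsUmbilicMetric

end Boundary

/-! ### Time derivatives along the flow and the two boundary identities in coordinates. -/

section Flow

variable {n : ℕ} [NeZero n] {S : Set (EuclideanSpace ℝ (Fin n))} {y : EuclideanSpace ℝ (Fin n)}
  {J : Set ℝ} {κ t : ℝ} {G : ℝ → EuclideanSpace ℝ (Fin n) → Matrix (Fin n) (Fin n) ℝ}

/-- A Ricci flow in one coordinate system, with umbilic boundary. -/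
structure IsCoordFlow (κ : ℝ) (J : Set ℝ) (S : Set (EuclideanSpace ℝ (Fin n)))
    (G : ℝ → EuclideanSpace ℝ (Fin n) → Matrix (Fin n) (Fin n) ℝ) : Prop where
  isOpen : IsOpen J
  metric : ∀ t ∈ J, IsUmbilicMetric κ S (G t)
  smooth : ∀ i j, ContDiffOn ℝ ∞
    (fun z : ℝ × EuclideanSpace ℝ (Fin n) => G z.1 z.2 i j) (J ×ˢ S)
  flow : ∀ t ∈ J, ∀ y ∈ S, ∀ i j,
    HasDerivAt (fun s => G s y i j) (-2 * ricci S (G t) i j y) t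

namespace IsCoordFlow

/-- A shortcut through the flow: Ricci is `-1/2` times the time derivative of a symmetric matrix, so
no algebraic Bianchi identity is needed. -/
theorem ricci_symm (h : IsCoordFlow κ J S G) (ht : t ∈ J) (hy : y ∈ S) (i j : Fin n) :
    ricci S (G t) i j y = ricci S (G t) j i y := by
  have h1 := (h.flow t ht y hy j i).congr_of_eventuallyEq (f₁ := fun s => G s y i j) (by
    filter_upwards [h.isOpen.mem_nhds ht] with s hs using (h.metric s hs).symm hy i j)
  linarith [(h.flow t ht y hy i j).unique h1]

theorem covRicci_symm (h : IsCoordFlow κ J S G) (ht : t ∈ J) (hy : y ∈ S) (k i j : Fin n) :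
    covRicci S (G t) k i j y = covRicci S (G t) k j i y := by
  unfold covRicci
  rw [pd_congr (fun z hz => h.ricci_symm ht hz i j) hy]
  congr 1
  refine Finset.sum_congr rfl fun l _ => ?_
  rw [h.ricci_symm ht hy l j, h.ricci_symm ht hy i l, add_comm]

theorem hasDerivAt_inv (h : IsCoordFlow κ J S G) (ht : t ∈ J) (hy : y ∈ S) (i j : Fin n) :
    HasDerivAt (fun s => (G s y)⁻¹ i j)
      (2 * ((G t y)⁻¹ * ricciMat S (G t) y * (G t y)⁻¹) i j) t := by
  have hd : ∀ i j, DifferentiableAt ℝ (fun s => (G s y)⁻¹ i j) t := by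
    intro i j
    refine ((contDiffOn_matrix_inv (s := J) (A := fun s => G s y) (fun k l => ?_)
      (fun s hs => ((h.metric s hs).isUnit_det hy).ne_zero) i j).contDiffAt
      (h.isOpen.mem_nhds ht)).differentiableAt (by simp)
    exact (h.smooth k l).comp (contDiffOn_id.prodMk contDiffOn_const) fun s hs => ⟨hs, hy⟩
  let D : Matrix (Fin n) (Fin n) ℝ := Matrix.of fun i j => deriv (fun s => (G s y)⁻¹ i j) t
  -- The time derivative of `g⁻¹ g = 1`, to be solved for `D`.
  have h1 : D * G t y + (G t y)⁻¹ * ((-2 : ℝ) • ricciMat S (G t) y) = 0 := by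
    ext i j
    have h2 : HasDerivAt (fun s => ∑ k, (G s y)⁻¹ i k * G s y k j)
        (∑ k, (D i k * G t y k j + (G t y)⁻¹ i k * (-2 * ricci S (G t) k j y))) t :=
      HasDerivAt.fun_sum fun k _ => (hd i k).hasDerivAt.mul (h.flow t ht y hy k j)
    have h3 : HasDerivAt (fun s => ∑ k, (G s y)⁻¹ i k * G s y k j) 0 t := by
      refine (hasDerivAt_const t ((1 : Matrix (Fin n) (Fin n) ℝ) i j)).congr_of_eventuallyEq ?_
      filter_upwards [h.isOpen.mem_nhds ht] with s hs
      rw [← (h.metric s hs).inv_mul hy, Matrix.mul_apply]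
    rw [Matrix.zero_apply, ← h2.unique h3, Finset.sum_add_distrib]
    rfl
  have h4 : D = (2 : ℝ) • ((G t y)⁻¹ * ricciMat S (G t) y * (G t y)⁻¹) := by
    have h5 := congrArg (fun X => X * (G t y)⁻¹) h1
    simp only [add_mul, zero_mul, mul_assoc, (h.metric t ht).mul_inv hy, mul_one, neg_smul,
      mul_neg, Matrix.mul_smul, neg_mul, Matrix.smul_mul] at h5
    rw [mul_assoc]
    exact eq_of_sub_eq_zero (by rw [sub_eq_add_neg]; exact h5)
  have h6 := (hd i j).hasDerivAt
  rwa [show deriv (fun s => (G s y)⁻¹ i j) t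
    = 2 * ((G t y)⁻¹ * ricciMat S (G t) y * (G t y)⁻¹) i j from congrFun (congrFun h4 i) j] at h6

/-- From `∂_t g^{00} = 2 R^{00}`; the vanishing of `R_{βν}` collapses `R^{00}` to `g^{00} R_{νν}`,
so that `∂_t w = w R_{νν}`. -/
theorem hasDerivAt_conormalLength (h : IsCoordFlow κ J S G) (ht : t ∈ J) (hy : y ∈ S)
    (hy0 : y 0 = 0) : HasDerivAt (fun s => conormalLength (G s) y)
      (conormalLength (G t) y * ricciConormal S (G t) 0 y) t := by
  have hm := h.metric t ht
  have h1 : HasDerivAt (fun s => conormalLength (G s) y)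
      (2 * ((G t y)⁻¹ * ricciMat S (G t) y * (G t y)⁻¹) 0 0 / (2 * conormalLength (G t) y)) t :=
    (h.hasDerivAt_inv ht hy 0 0).sqrt (hm.inv_zero_zero_pos hy).ne'
  have h2 : ((G t y)⁻¹ * ricciMat S (G t) y * (G t y)⁻¹) 0 0
      = (G t y)⁻¹ 0 0 * ricciConormal S (G t) 0 y := by
    rw [mul_assoc, Matrix.mul_apply, Finset.sum_eq_single 0]
    · rfl
    · intro i _ hi
      rw [show (ricciMat S (G t) y * (G t y)⁻¹) i 0 = 0 from
        hm.ricciConormal_eq_zero hy hy0 hi, mul_zero]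
    · simp
  have hw := (hm.conormalLength_pos hy).ne'
  convert h1 using 1
  rw [h2, ← hm.conormalLength_mul_self hy]
  field_simp

/-- The variation `∂_t Γ^k_{ij} = -g^{kl} (∇_i R_{jl} + ∇_j R_{il} - ∇_l R_{ij})`. -/
theorem hasDerivAt_christoffel (h : IsCoordFlow κ J S G) (ht : t ∈ J) (hy : y ∈ S)
    (k i j : Fin n) : HasDerivAt (fun s => christoffel S (G s) k i j y)
      (-∑ l, (G t y)⁻¹ k l * (covRicci S (G t) i j l y + covRicci S (G t) j i l y
        - covRicci S (G t) l i j y)) t := by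
  have hm := h.metric t ht
  have hpd : ∀ a b c, HasDerivAt (fun s => pd S a (fun z => G s z b c) y)
      (-2 * pd S a (ricci S (G t) b c) y) t := by
    intro a b c
    have h1 := hasDerivAt_pd h.isOpen hm.uniqueDiffOn hm.subset_closure (h.smooth b c) ht
      (fun z hz => h.flow t ht z hz b c) hy a
    rwa [pd_mul hm.uniqueDiffOn contDiffOn_const (hm.smooth_ricci b c) hy, pd_const, zero_mul,
      zero_add] at h1
  set v : Fin n → ℝ := fun l => pd S i (fun z => G t z j l) y
      + pd S j (fun z => G t z i l) y - pd S l (fun z => G t z i j) y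
  set Q := (G t y)⁻¹ * ricciMat S (G t) y * (G t y)⁻¹
  have h1 : HasDerivAt (fun s => christoffel S (G s) k i j y)
      ((1 / 2) * ∑ l, (2 * Q k l * v l + (G t y)⁻¹ k l * (-2 * pd S i (ricci S (G t) j l) y
        + -2 * pd S j (ricci S (G t) i l) y - -2 * pd S l (ricci S (G t) i j) y))) t :=
    (HasDerivAt.fun_sum fun l _ => (h.hasDerivAt_inv ht hy k l).mul
      (((hpd i j l).add (hpd j i l)).sub (hpd l i j))).const_mul _
  -- Here `v = 2 g Γ`, so the variation of the inverse metric contributes `g⁻¹ Ric Γ`; this is what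
  -- turns the partial derivatives of Ricci into covariant ones.
  have h2 : ∑ l, Q k l * v l = 2 * ∑ l, (G t y)⁻¹ k l
      * ∑ m, christoffel S (G t) m i j y * ricci S (G t) m l y := by
    have hv : v = (2 : ℝ) • (G t y).mulVec (fun m => christoffel S (G t) m i j y) := by
      ext l
      have := hm.sum_mul_christoffel hy l i j
      change v l = 2 * ∑ m, G t y l m * christoffel S (G t) m i j y
      rw [this]
      ring
    have h3 : Q.mulVec v = (2 : ℝ) • (G t y)⁻¹.mulVec ((ricciMat S (G t) y).mulVec
        (fun m => christoffel S (G t) m i j y)) := by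
      rw [hv, Matrix.mulVec_smul, Matrix.mulVec_mulVec, Matrix.mulVec_mulVec, mul_assoc,
        hm.inv_mul hy, mul_one]
    have h4 := congrFun h3 k
    change ∑ l, Q k l * v l = 2 * ∑ l, (G t y)⁻¹ k l
      * ∑ m, ricci S (G t) l m y * christoffel S (G t) m i j y at h4
    rw [h4]
    congr 1
    refine Finset.sum_congr rfl fun l _ => ?_
    congr 1
    exact Finset.sum_congr rfl fun m _ => by rw [h.ricci_symm ht hy l m, mul_comm]
  have h5 : ∀ l, pd S i (ricci S (G t) j l) y + pd S j (ricci S (G t) i l) y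
      - pd S l (ricci S (G t) i j) y
      = covRicci S (G t) i j l y + covRicci S (G t) j i l y - covRicci S (G t) l i j y
        + 2 * ∑ m, christoffel S (G t) m i j y * ricci S (G t) m l y := by
    intro l
    have e1 : ∑ m, christoffel S (G t) m j i y * ricci S (G t) m l y
        = ∑ m, christoffel S (G t) m i j y * ricci S (G t) m l y :=
      Finset.sum_congr rfl fun m _ => by rw [hm.christoffel_symm hy m j i]
    have e2 : ∑ m, christoffel S (G t) m l i y * ricci S (G t) m j y
        = ∑ m, christoffel S (G t) m i l y * ricci S (G t) j m y :=
      Finset.sum_congr rfl fun m _ => by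
        rw [hm.christoffel_symm hy m l i, h.ricci_symm ht hy m j]
    have e3 : ∑ m, christoffel S (G t) m l j y * ricci S (G t) i m y
        = ∑ m, christoffel S (G t) m j l y * ricci S (G t) i m y :=
      Finset.sum_congr rfl fun m _ => by rw [hm.christoffel_symm hy m l j]
    rw [IsCoordMetric.pd_ricci, IsCoordMetric.pd_ricci, IsCoordMetric.pd_ricci, e1, e2, e3]
    ring
  convert h1 using 1
  have h6 : ∀ l, 2 * Q k l * v l + (G t y)⁻¹ k l * (-2 * pd S i (ricci S (G t) j l) y
        + -2 * pd S j (ricci S (G t) i l) y - -2 * pd S l (ricci S (G t) i j) y)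
      = 2 * (Q k l * v l) - 2 * ((G t y)⁻¹ k l * (covRicci S (G t) i j l y
        + covRicci S (G t) j i l y - covRicci S (G t) l i j y))
        - 4 * ((G t y)⁻¹ k l * ∑ m, christoffel S (G t) m i j y * ricci S (G t) m l y) := by
    intro l
    linear_combination (-2) * (G t y)⁻¹ k l * h5 l
  simp only [h6, Finset.sum_sub_distrib, ← Finset.mul_sum, h2]
  ring

/-- `g^{0k} ∇_k R_{αβ}` on the boundary. -/
theorem sum_covRicci_conormal (h : IsCoordFlow κ J S G) (ht : t ∈ J) (hy : y ∈ S) (hy0 : y 0 = 0)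
    {α β : Fin n} (hα : α ≠ 0) (hβ : β ≠ 0) :
    ∑ k, (G t y)⁻¹ 0 k * covRicci S (G t) k α β y
      = -(κ * conormalLength (G t) y * G t y α β * ricciConormal S (G t) 0 y) := by
  have hm := h.metric t ht
  have h1 := h.hasDerivAt_christoffel ht hy 0 α β
  have h2 := ((h.hasDerivAt_conormalLength ht hy hy0).const_mul κ).mul (h.flow t ht y hy α β)
  -- The boundary condition holds for all nearby times at the same boundary point, so both sides of
  -- `Γ^0_{αβ} = κ w g_{αβ}` have the same time derivative.
  have h3 := h1.unique (h2.congr_of_eventuallyEq (by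
    filter_upwards [h.isOpen.mem_nhds ht] with s hs using
      (h.metric s hs).christoffel_zero hy hy0 hα hβ))
  simp only [mul_sub, mul_add, Finset.sum_sub_distrib, Finset.sum_add_distrib] at h3
  rw [hm.sum_covRicci_tangential hy hy0 hα hβ, hm.sum_covRicci_tangential hy hy0 hβ hα,
    hm.symm hy β α, h.ricci_symm ht hy β α] at h3
  linear_combination h3

theorem sum_normal_mul (f : Fin n → ℝ) : ∑ k, normal (G t) k y * f k
    = -(∑ k, (G t y)⁻¹ k 0 * f k) / conormalLength (G t) y := by
  rw [← Finset.sum_neg_distrib, Finset.sum_div]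
  refine Finset.sum_congr rfl fun k _ => ?_
  simp only [normal, conormalLength]
  ring

theorem sum_normal_mul_covRicci (h : IsCoordFlow κ J S G) (ht : t ∈ J) (hy : y ∈ S)
    (hy0 : y 0 = 0) {α β : Fin n} (hα : α ≠ 0) (hβ : β ≠ 0) :
    ∑ k, normal (G t) k y * covRicci S (G t) k α β y
      = ricciNN S (G t) y * secondFF S (G t) α β y := by
  have hm := h.metric t ht
  have hw := (hm.conormalLength_pos hy).ne'
  rw [sum_normal_mul, hm.ricciNN_eq hy hy0, hm.umbilic y hy hy0 α β hα hβ]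
  simp only [hm.inv_symm hy _ 0]
  rw [h.sum_covRicci_conormal ht hy hy0 hα hβ]
  field_simp

theorem sum_normal_mul_pd_scalarCurv (h : IsCoordFlow κ J S G) (ht : t ∈ J) (hy : y ∈ S)
    (hy0 : y 0 = 0) : ∑ k, normal (G t) k y * pd S k (scalarCurv S (G t)) y
      = 2 * κ * tangentialTraceRicci S (G t) y := by
  have hm := h.metric t ht
  have hw := (hm.conormalLength_pos hy).ne'
  set gi := (G t y)⁻¹
  set C := fun k i j => covRicci S (G t) k i j y
  set τ := tangentialInv (G t) y
  -- The purely normal term, a multiple of `∇_ν R_{νν}`. It is the same in the expansions `h1` and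
  -- `h2` of the normal derivative; twice the first minus the second eliminates it, leaving twice
  -- the difference computed in `h3`.
  set Z := ∑ i, ∑ j, gi i 0 * gi 0 j / gi 0 0 * ∑ k, gi 0 k * C k i j
  have hg : ∀ i j, gi i j = τ i j + gi i 0 * gi 0 j / gi 0 0 := fun i j => by
    simp only [τ, tangentialInv, gi]; ring
  have hsymm : ∀ i j, gi i j = gi j i := hm.inv_symm hy
  have h1 : ∑ k, gi k 0 * pd S k (scalarCurv S (G t)) y
      = ∑ i, ∑ j, τ i j * (∑ k, gi 0 k * C k i j) + Z := by
    rw [← Finset.sum_add_distrib]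
    simp only [← Finset.sum_add_distrib, ← add_mul, ← hg]
    simp only [hm.pd_scalarCurv hy, Finset.mul_sum]
    rw [Finset.sum_comm]
    refine Finset.sum_congr rfl fun i _ => ?_
    rw [Finset.sum_comm]
    refine Finset.sum_congr rfl fun j _ => Finset.sum_congr rfl fun k _ => ?_
    rw [hsymm k 0]
    ring
  have hZ : Z = ∑ i, ∑ j, gi i 0 * gi 0 j / gi 0 0 * ∑ l, gi 0 l * C i j l := by
    simp only [Z, Finset.mul_sum]
    rw [Finset.sum_congr rfl fun i _ => Finset.sum_comm, Finset.sum_comm]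
    refine Finset.sum_congr rfl fun k _ => ?_
    refine Finset.sum_congr rfl fun i _ => Finset.sum_congr rfl fun j _ => ?_
    rw [hsymm k 0, hsymm i 0]
    ring
  have h2 : ∑ k, gi k 0 * pd S k (scalarCurv S (G t)) y
      = 2 * (∑ i, ∑ j, τ i j * (∑ l, gi 0 l * C i j l) + Z) := by
    rw [hZ, ← Finset.sum_add_distrib]
    simp only [← Finset.sum_add_distrib, ← add_mul, ← hg]
    simp only [hm.pd_scalarCurv hy, hm.contracted_bianchi hy, Finset.mul_sum]
    rw [Finset.sum_comm]
    refine Finset.sum_congr rfl fun i _ => ?_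
    rw [Finset.sum_comm]
    refine Finset.sum_congr rfl fun j _ => Finset.sum_congr rfl fun k _ => ?_
    rw [hsymm k 0, h.covRicci_symm ht hy i k j]
    ring
  have h3 : ∑ i, ∑ j, τ i j * (∑ k, gi 0 k * C k i j)
      - ∑ i, ∑ j, τ i j * (∑ l, gi 0 l * C i j l)
      = -(κ * conormalLength (G t) y * tangentialTraceRicci S (G t) y) := by
    rw [hm.tangentialTraceRicci_eq hy, sum_eq_of_tangential
        (Y := fun i j => -(κ * conormalLength (G t) y * G t y i j * ricciConormal S (G t) 0 y))
        (hm.tangentialInv_zero_right hy) (hm.tangentialInv_zero_left hy)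
        (fun i j hi hj => h.sum_covRicci_conormal ht hy hy0 hi hj),
      sum_eq_of_tangential (hm.tangentialInv_zero_right hy) (hm.tangentialInv_zero_left hy)
        (fun i j hi hj => hm.sum_covRicci_tangential hy hy0 hi hj)]
    simp only [Finset.mul_sum, ← Finset.sum_sub_distrib, ← Finset.sum_neg_distrib]
    refine Finset.sum_congr rfl fun i _ => Finset.sum_congr rfl fun j _ => ?_
    rw [h.ricci_symm ht hy j i]
    ring
  rw [sum_normal_mul, show ∑ k, gi k 0 * pd S k (scalarCurv S (G t)) y
    = -(2 * (κ * conormalLength (G t) y * tangentialTraceRicci S (G t) y)) by linarith]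
  field_simp

end IsCoordFlow

end Flow

/-! ### From the manifold to coordinate domains. -/

section Charts

variable {n : ℕ} [NeZero n] {M : Type*} [TopologicalSpace M]

theorem coordDomain_eq (e : OpenPartialHomeomorph M (EuclideanHalfSpace n)) :
    coordDomain e = (𝓡∂ n).symm ⁻¹' e.target ∩ {z | 0 ≤ z 0} := by
  rw [coordDomain, e.extend_target, range_modelWithCornersEuclideanHalfSpace]

theorem coordDomain_mem_nhdsWithin (e : OpenPartialHomeomorph M (EuclideanHalfSpace n))
    {y : EuclideanSpace ℝ (Fin n)} (hy : y ∈ coordDomain e) :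
    coordDomain e ∈ nhdsWithin y (range (𝓡∂ n)) := by
  rw [coordDomain, e.extend_target] at *
  exact inter_comm _ _ ▸ inter_mem_nhdsWithin _
    ((e.open_target.preimage (𝓡∂ n).continuous_symm).mem_nhds hy.1)

theorem uniqueDiffOn_coordDomain (e : OpenPartialHomeomorph M (EuclideanHalfSpace n)) :
    UniqueDiffOn ℝ (coordDomain e) := by
  rw [coordDomain, e.extend_target]
  exact (𝓡∂ n).uniqueDiffOn_preimage e.open_target

theorem coordDomain_subset_closure_interior
    (e : OpenPartialHomeomorph M (EuclideanHalfSpace n)) :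
    coordDomain e ⊆ closure (interior (coordDomain e)) := by
  have hU := e.open_target.preimage (𝓡∂ n).continuous_symm
  rw [coordDomain, e.extend_target, interior_inter, hU.interior_eq]
  exact fun y hy => hU.inter_closure ⟨hy.1, (𝓡∂ n).range_subset_closure_interior hy.2⟩

theorem bilinear_sum_smul {ι V : Type*} [Fintype ι] [AddCommGroup V] [Module ℝ V]
    [TopologicalSpace V] (B : V →L[ℝ] V →L[ℝ] ℝ) (x : ι → ℝ) (v : ι → V) :
    B (∑ i, x i • v i) (∑ i, x i • v i)
      = star x ⬝ᵥ ((Matrix.of fun i j => B (v i) (v j)).mulVec x) := by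
  simp only [map_sum, map_smul, sum_apply, smul_apply, smul_eq_mul, dotProduct, Matrix.mulVec,
    Matrix.of_apply, star_trivial, Finset.mul_sum]
  rw [Finset.sum_comm]
  exact Finset.sum_congr rfl fun i _ => Finset.sum_congr rfl fun j _ => by ring

variable [ChartedSpace (EuclideanHalfSpace n) M]

/-- Boundary points are defined through the preferred chart. A smooth chart has surjective
differential, as does its inverse, and such maps send interior points to interior points, so any
chart `e` of the maximal atlas detects the boundary. -/
theorem extend_apply_zero_eq_zero_iff [IsManifold (𝓡∂ n) ∞ M]
    {e : OpenPartialHomeomorph M (EuclideanHalfSpace n)}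
    (he : e ∈ IsManifold.maximalAtlas (𝓡∂ n) ∞ M) {p : M} (hp : p ∈ e.source) :
    e.extend (𝓡∂ n) p 0 = 0 ↔ p ∈ (𝓡∂ n).boundary M := by
  have : IsManifold (𝓡∂ n) 1 M := IsManifold.of_le (n := ∞) ENat.LEInfty.out
  have hd : e.MDifferentiable (𝓡∂ n) (𝓡∂ n) :=
    ⟨(contMDiffOn_of_mem_maximalAtlas he).mdifferentiableOn (by simp),
      (contMDiffOn_symm_of_mem_maximalAtlas he).mdifferentiableOn (by simp)⟩
  have h1 : (𝓡∂ n).IsInteriorPoint p ↔ (𝓡∂ n).IsInteriorPoint (e p) := by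
    refine ⟨(hd.mdifferentiableAt hp).isInteriorPoint_of_surjective_mfderiv
      (hd.mfderiv_surjective hp), fun h => ?_⟩
    have h2 := (hd.symm.mdifferentiableAt (e.map_source hp)).isInteriorPoint_of_surjective_mfderiv
      (hd.symm.mfderiv_surjective (e.map_source hp)) h
    rwa [e.left_inv hp] at h2
  have h2 : (𝓡∂ n).IsInteriorPoint (e p) ↔ 0 < e.extend (𝓡∂ n) p 0 := by
    rw [ModelWithCorners.IsInteriorPoint, interior_range_modelWithCornersEuclideanHalfSpace]
    exact Iff.rfl
  have h3 : 0 ≤ e.extend (𝓡∂ n) p 0 := (e p).2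
  rw [← ModelWithCorners.compl_interior, mem_compl_iff]
  change _ ↔ ¬ (𝓡∂ n).IsInteriorPoint p
  rw [h1, h2]
  constructor
  · intro h; rw [h]; exact lt_irrefl 0
  · intro h; exact le_antisymm (not_lt.1 h) h3

theorem injective_mfderivWithin_extend_symm [IsManifold (𝓡∂ n) ∞ M]
    {e : OpenPartialHomeomorph M (EuclideanHalfSpace n)}
    (he : e ∈ IsManifold.maximalAtlas (𝓡∂ n) ∞ M) {y : EuclideanSpace ℝ (Fin n)}
    (hy : y ∈ coordDomain e) :
    Function.Injective (mfderivWithin 𝓘(ℝ, EuclideanSpace ℝ (Fin n)) (𝓡∂ n)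
      (e.extend (𝓡∂ n)).symm (range (𝓡∂ n)) y) := by
  have hyr : y ∈ range (𝓡∂ n) := e.extend_target_subset_range hy
  have U : UniqueMDiffWithinAt 𝓘(ℝ, EuclideanSpace ℝ (Fin n)) (range (𝓡∂ n)) y :=
    (𝓡∂ n).uniqueMDiffOn _ hyr
  have hsrc : (e.extend (𝓡∂ n)).symm y ∈ e.source := by
    have := (e.extend (𝓡∂ n)).map_target hy
    rwa [e.extend_source] at this
  have h1 : MDifferentiableAt (𝓡∂ n) 𝓘(ℝ, EuclideanSpace ℝ (Fin n)) (e.extend (𝓡∂ n))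
      ((e.extend (𝓡∂ n)).symm y) :=
    (e.contMDiffAt_extend he hsrc).mdifferentiableAt (by simp)
  have h2 : MDifferentiableWithinAt 𝓘(ℝ, EuclideanSpace ℝ (Fin n)) (𝓡∂ n)
      (e.extend (𝓡∂ n)).symm (range (𝓡∂ n)) y := by
    have := (contMDiffOn_extend_symm he).mdifferentiableOn (by simp) y
      (by rw [← e.extend_target']; exact hy)
    rw [← e.extend_target'] at this
    exact this.mono_of_mem_nhdsWithin (coordDomain_mem_nhdsWithin e hy)
  have h3 : (mfderiv (𝓡∂ n) 𝓘(ℝ, EuclideanSpace ℝ (Fin n)) (e.extend (𝓡∂ n))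
        ((e.extend (𝓡∂ n)).symm y)) ∘L
      (mfderivWithin 𝓘(ℝ, EuclideanSpace ℝ (Fin n)) (𝓡∂ n)
        (e.extend (𝓡∂ n)).symm (range (𝓡∂ n)) y) = ContinuousLinearMap.id _ _ := by
    rw [← mfderiv_comp_mfderivWithin y h1 h2 U, ← mfderivWithin_id U]
    apply Filter.EventuallyEq.mfderivWithin_eq
    · filter_upwards [coordDomain_mem_nhdsWithin e hy] with z hz
      simp only [Function.comp_def, PartialEquiv.right_inv (e.extend (𝓡∂ n)) hz, id_eq]
    · simp only [Function.comp_def, PartialEquiv.right_inv (e.extend (𝓡∂ n)) hy, id_eq]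
  intro v w hvw
  have h4 := congrArg (mfderiv (𝓡∂ n) 𝓘(ℝ, EuclideanSpace ℝ (Fin n)) (e.extend (𝓡∂ n))
        ((e.extend (𝓡∂ n)).symm y)) hvw
  rw [← ContinuousLinearMap.comp_apply, ← ContinuousLinearMap.comp_apply, h3] at h4
  exact h4

/-- The quadratic form of the coefficient matrix is the metric evaluated on the image of a
coordinate vector, which is nonzero because the differential of the inverse chart is injective, also
at the boundary. -/
theorem posDef_coeff [IsManifold (𝓡∂ n) ∞ M]
    (g : RiemannianMetric (fun x : M => TangentSpace (𝓡∂ n) x))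
    {e : OpenPartialHomeomorph M (EuclideanHalfSpace n)}
    (he : e ∈ IsManifold.maximalAtlas (𝓡∂ n) ∞ M) {y : EuclideanSpace ℝ (Fin n)}
    (hy : y ∈ coordDomain e) : (coeff g e y).PosDef := by
  refine Matrix.PosDef.of_dotProduct_mulVec_pos ?_ fun x hx => ?_
  · ext i j
    exact g.symm _ _ _
  set L := mfderivWithin 𝓘(ℝ, EuclideanSpace ℝ (Fin n)) (𝓡∂ n)
      (e.extend (𝓡∂ n)).symm (range (𝓡∂ n)) y
  set u : EuclideanSpace ℝ (Fin n) := WithLp.toLp 2 x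
  have hu : u = ∑ i, x i • EuclideanSpace.single i (1 : ℝ) := by
    ext j
    simp [u, Finset.sum_apply, Pi.single_apply]
  have hLu : L u = ∑ i, x i • coordVector e i y := by
    rw [hu]
    exact (map_sum L _ _).trans (Finset.sum_congr rfl fun i _ => L.map_smul _ _)
  have hne : L u ≠ 0 := by
    intro h0
    have h1 : u = 0 := injective_mfderivWithin_extend_symm he hy (h0.trans (map_zero L).symm)
    exact hx (by simpa [u] using h1)
  have h1 := g.pos _ (L u) hne
  rw [hLu] at h1
  exact h1.trans_eq (bilinear_sum_smul _ _ _)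

theorem IsUmbilicRicciFlow.isCoordFlow [IsManifold (𝓡∂ n) ∞ M] {κ T : ℝ}
    {g : ℝ → RiemannianMetric (fun x : M => TangentSpace (𝓡∂ n) x)}
    (hg : IsUmbilicRicciFlow κ T g) {e : OpenPartialHomeomorph M (EuclideanHalfSpace n)}
    (he : e ∈ IsManifold.maximalAtlas (𝓡∂ n) ∞ M) :
    IsCoordFlow κ (Ioo 0 T) (coordDomain e) (fun t => coeff (g t) e) := by
  have hsrc : ∀ y ∈ coordDomain e, (e.extend (𝓡∂ n)).symm y ∈ e.source := fun y hy => by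
    have := (e.extend (𝓡∂ n)).map_target hy
    rwa [e.extend_source] at this
  have hinv : ∀ y ∈ coordDomain e, e.extend (𝓡∂ n) ((e.extend (𝓡∂ n)).symm y) = y :=
    fun y hy => (e.extend (𝓡∂ n)).right_inv hy
  refine ⟨isOpen_Ioo, fun t ht => ⟨⟨uniqueDiffOn_coordDomain e,
    coordDomain_subset_closure_interior e, fun i j => ?_, fun z hz => posDef_coeff (g t) he hz⟩,
    ⟨_, e.open_target.preimage (𝓡∂ n).continuous_symm, coordDomain_eq e⟩,
    fun z hz hz0 α β hα hβ => ?_⟩, hg.smooth e he, fun t ht y hy i j => ?_⟩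
  · exact (hg.smooth e he i j).comp (contDiffOn_const.prodMk contDiffOn_id)
      fun z hz => ⟨ht, hz⟩
  · have := hg.umbilic e he t ht _ ((extend_apply_zero_eq_zero_iff he (hsrc z hz)).1
      (by rw [hinv z hz]; exact hz0)) (hsrc z hz) α β hα hβ
    rwa [hinv z hz] at this
  · have := hg.flow e he t ht _ (hsrc y hy) i j
    rwa [hinv y hy] at this

end Charts

end UmbilicRicciFlow

end

/-- On the boundary of a Ricci flow with `h = κ g`, `κ` constant, one has
`∇_ν R_{αβ} = R_{νν} h_{αβ}` for tangential indices and `∂_ν R = 2 κ g^{αβ} R_{αβ}`. -/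
theorem mainTheorem7 {n : ℕ} [NeZero n] {M : Type*} [TopologicalSpace M]
    [ChartedSpace (EuclideanHalfSpace n) M] [IsManifold (𝓡∂ n) ∞ M]
    (κ T : ℝ) (g : ℝ → RiemannianMetric (fun x : M => TangentSpace (𝓡∂ n) x))
    (hg : UmbilicRicciFlow.IsUmbilicRicciFlow κ T g)
    (t : ℝ) (ht : t ∈ Ioo 0 T) (p : M) (hp : p ∈ (𝓡∂ n).boundary M)
    (e : OpenPartialHomeomorph M (EuclideanHalfSpace n))
    (he : e ∈ IsManifold.maximalAtlas (𝓡∂ n) ∞ M) (hpe : p ∈ e.source) :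
    (∀ α β : Fin n, α ≠ 0 → β ≠ 0 →
      ∑ k, UmbilicRicciFlow.normal (UmbilicRicciFlow.coeff (g t) e) k (e.extend (𝓡∂ n) p)
          * UmbilicRicciFlow.covRicci (UmbilicRicciFlow.coordDomain e)
              (UmbilicRicciFlow.coeff (g t) e) k α β (e.extend (𝓡∂ n) p)
        = UmbilicRicciFlow.ricciNN (UmbilicRicciFlow.coordDomain e)
              (UmbilicRicciFlow.coeff (g t) e) (e.extend (𝓡∂ n) p)
          * UmbilicRicciFlow.secondFF (UmbilicRicciFlow.coordDomain e)
              (UmbilicRicciFlow.coeff (g t) e) α β (e.extend (𝓡∂ n) p)) ∧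
    ∑ k, UmbilicRicciFlow.normal (UmbilicRicciFlow.coeff (g t) e) k (e.extend (𝓡∂ n) p)
        * UmbilicRicciFlow.pd (UmbilicRicciFlow.coordDomain e) k
            (UmbilicRicciFlow.scalarCurv (UmbilicRicciFlow.coordDomain e)
              (UmbilicRicciFlow.coeff (g t) e)) (e.extend (𝓡∂ n) p)
      = 2 * κ * UmbilicRicciFlow.tangentialTraceRicci (UmbilicRicciFlow.coordDomain e)
          (UmbilicRicciFlow.coeff (g t) e) (e.extend (𝓡∂ n) p) := by
  have h := hg.isCoordFlow he
  have hy : e.extend (𝓡∂ n) p ∈ UmbilicRicciFlow.coordDomain e :=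
    (e.extend (𝓡∂ n)).map_source (by rwa [e.extend_source])
  have hy0 := (UmbilicRicciFlow.extend_apply_zero_eq_zero_iff he hpe).2 hp
  exact ⟨fun α β hα hβ => h.sum_normal_mul_covRicci ht hy hy0 hα hβ,
    h.sum_normal_mul_pd_scalarCurv ht hy hy0⟩
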